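/- Let $(A_1, \tau_1), (A_2, \tau_2), (A_3, \tau_3), \ldots$ be unital C*-algebras with given (not necessarily faithful) states. For $n \ge 1$ let $B_n = (A_1, \tau_1) *_{\mathrm r} \cdots *_{\mathrm r} (A_n, \tau_n)$ be their reduced free product (amalgamated over $\mathbb{C} \cdot 1$), that is, the C*-algebra generated by the images of $A_1, \ldots, A_n$ acting on the free product of the pointed GNS Hilbert spaces of $(A_k, \tau_k)$, $1 \le k \le n$, equipped with the free product state $\tau_1 *_{\mathrm r} \cdots *_{\mathrm r} \tau_n$, which is the vector state given by the distinguished vector. Let $\iota_n \colon B_n \to B_{n+1}$ be the inclusion as the first $n$ free factors, that is, the unital *-homomorphism which sends the image of $a \in A_k$ in $B_n$ to the image of $a$ in $B_{n+1}$ for $1 \le k \le n$. For every $n$ let $\gamma_n \in \operatorname{Aut}(B_n)$ be a *-automorphism which preserves the free product state: $(\tau_1 *_{\mathrm r} \cdots *_{\mathrm r} \tau_n) \circ \gamma_n = \tau_1 *_{\mathrm r} \cdots *_{\mathrm r} \tau_n$. Then the C*-algebraic direct limits satisfy \[ \varinjlim \bigl( (B_n)_{n \ge 1}, (\gamma_{n+1}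 \circ \iota_n)_{n \ge 1} \bigr) \cong \varinjlim \bigl( (B_n)_{n \ge 1}, (\iota_n)_{n \ge 1} \bigr) \] as C*-algebras. -/

import Mathlib

open scoped ComplexOrder InnerProductSpace ComplexConjugate

/-- A state on a unital C⋆-algebra: a unital positive linear functional. -/
structure CStarState (A : Type*) [CStarAlgebra A] where
  toLinearMap : A →ₗ[ℂ] ℂ
  map_star_mul_self_nonneg : ∀ a, 0 ≤ toLinearMap (star a * a)
  map_one : toLinearMap 1 = 1

namespace CStarState

noncomputable instance {A : Type*} [CStarAlgebra A] : CoeFun (CStarState A) (fun _ => A → ℂ) :=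
  ⟨fun τ => τ.toLinearMap⟩

/-- The centring `a ↦ a - τ(a) 1`, the projection of `A` onto `ker τ` along `ℂ 1`. -/
noncomputable def center {A : Type*} [CStarAlgebra A] (τ : CStarState A) : A →ₗ[ℂ] A :=
  LinearMap.id - τ.toLinearMap.smulRight (1 : A)

section
variable {A : Type*} [CStarAlgebra A] (τ : CStarState A)

theorem center_apply (a : A) : τ.center a = a - τ a • (1 : A) := rfl

theorem conj_star_mul (a b : A) : conj (τ (star a * b)) = τ (star b * a) := by
  have h0 : ∀ x, (τ (star x * x)).im = 0 := fun x =>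
    ((Complex.nonneg_iff.1 (τ.map_star_mul_self_nonneg x)).2).symm
  have h1 := h0 (a + b)
  have h2 := h0 (a + Complex.I • b)
  simp only [star_add, star_smul, add_mul, mul_add, map_add, smul_mul_assoc, mul_smul_comm,
    map_smul, Complex.add_im, h0 a, h0 b, smul_eq_mul] at h1 h2
  simp [Complex.mul_im, Complex.mul_re, h0 b] at h1 h2
  apply Complex.ext
  · simp; linarith
  · simp; linarith

theorem map_star (a : A) : τ (star a) = conj (τ a) := by
  have := τ.conj_star_mul 1 a
  simpa using this.symm

theorem map_one' : τ 1 = 1 := τ.map_one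

theorem map_center (a : A) : τ (τ.center a) = 0 := by
  rw [center_apply, map_sub, map_smul, τ.map_one]; simp

theorem map_star_center_mul_center (a b : A) :
    τ (star (τ.center a) * τ.center b) = τ (star (τ.center a) * b) := by
  have h : τ (star (τ.center a)) = 0 := by rw [map_star, map_center]; simp
  rw [center_apply τ b, mul_sub, map_sub, mul_smul_comm, mul_one, map_smul, h]; simp

theorem map_star_mul_eq (a b : A) :
    τ (star a * b) = conj (τ a) * τ b + τ (star (τ.center a) * τ.center b) := by
  rw [map_star_center_mul_center, center_apply, star_sub, sub_mul, map_sub]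
  simp [← map_star]

theorem center_center (a : A) : τ.center (τ.center a) = τ.center a := by
  rw [center_apply τ (τ.center a), map_center]; simp

theorem center_one : τ.center (1 : A) = 0 := by
  rw [center_apply, τ.map_one]; simp
end

end CStarState

namespace ReducedFreeProduct

/-- A letter: an index together with an element of the algebra with this index.
The letter `⟨i, a⟩` stands for the centred element `a - τ i a` of `A i`. -/
abbrev Letter {I : Type*} (A : I → Type*) := Σ i, A i

/-- Alternating words: finite lists of letters, neighbours having different indices. -/
@[ext]
structure Word {I : Type*} (A : I → Type*) where
  toList : List (Letter A)
  isChain : toList.IsChain (fun x y => x.1 ≠ y.1)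

section
variable {I : Type*} {A : I → Type*} [∀ i, CStarAlgebra (A i)] (τ : ∀ i, CStarState (A i))

/-- The inner product `τᵢ((a - τᵢ(a))* (b - τᵢ(b)))` of two letters of the same index `i`;
letters with different indices are orthogonal. -/
noncomputable def letterInner (x y : Letter A) : ℂ :=
  open Classical in
  if h : x.1 = y.1 then τ y.1 (star ((τ y.1).center (h ▸ x.2)) * (τ y.1).center y.2) else 0

/-- The inner product of two words: the product of the inner products of their letters if they
have the same length, and zero otherwise. -/
noncomputable def wordInner : List (Letter A) → List (Letter A) → ℂ
  | [], [] => 1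
  | x :: u, y :: v => letterInner τ x y * wordInner u v
  | _, _ => 0

theorem letterInner_same (i : I) (a b : A i) :
    letterInner τ ⟨i, a⟩ ⟨i, b⟩ = τ i (star ((τ i).center a) * (τ i).center b) := by
  simp [letterInner]

theorem letterInner_ne {x y : Letter A} (h : x.1 ≠ y.1) : letterInner τ x y = 0 := by
  simp [letterInner, h]

theorem conj_letterInner (x y : Letter A) : conj (letterInner τ x y) = letterInner τ y x := by
  obtain ⟨i, a⟩ := x
  obtain ⟨j, b⟩ := y
  by_cases h : i = j
  · subst h; rw [letterInner_same, letterInner_same, CStarState.conj_star_mul]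
  · rw [letterInner_ne τ (by simpa using h), letterInner_ne τ (by simpa using Ne.symm h)]; simp

theorem conj_wordInner : ∀ u v : List (Letter A),
    conj (wordInner τ u v) = wordInner τ v u
  | [], [] => by simp [wordInner]
  | x :: u, y :: v => by simp [wordInner, conj_letterInner, conj_wordInner u v]
  | [], _ :: _ => by simp [wordInner]
  | _ :: _, [] => by simp [wordInner]

theorem wordInner_of_head_ne {i : I} {w v : List (Letter A)} (a : A i)
    (hw : ∀ x ∈ w.head?, x.1 ≠ i) : wordInner τ w (⟨i, a⟩ :: v) = 0 := by
  cases w with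
  | nil => rfl
  | cons x w => rw [wordInner, letterInner_ne τ (by simpa using hw)]; simp

/-- The component in `A i` of the centred head of a word. -/
noncomputable def headComp (i : I) : List (Letter A) → A i
  | [] => 0
  | x :: _ => open Classical in if h : x.1 = i then h ▸ (τ x.1).center x.2 else 0

theorem posSemidef_headComp (i : I) :
    (Matrix.of fun u v : List (Letter A) =>
      τ i (star (headComp τ i u) * headComp τ i v)).PosSemidef := by
  refine ⟨?_, fun x => ?_⟩
  · ext u v
    simp only [Matrix.conjTranspose_apply, Matrix.of_apply]
    exact CStarState.conj_star_mul _ _ _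
  · have h := (τ i).map_star_mul_self_nonneg (x.sum fun u c => c • headComp τ i u)
    convert h using 1
    simp only [Finsupp.sum, star_sum, Finset.sum_mul, Finset.mul_sum, map_sum, star_smul,
      smul_mul_assoc, mul_smul_comm, map_smul, Matrix.of_apply, smul_eq_mul]
    rw [Finset.sum_comm]
    refine Finset.sum_congr rfl fun u _ => Finset.sum_congr rfl fun v _ => ?_
    ring

theorem posSemidef_congr {S : Type*} {M : Matrix S S ℂ} (hM : M.IsHermitian)
    (h : ∀ F : Finset S, ∃ N : Matrix S S ℂ, N.PosSemidef ∧ ∀ s ∈ F, ∀ t ∈ F, M s t = N s t) :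
    M.PosSemidef := by
  refine ⟨hM, fun x => ?_⟩
  obtain ⟨N, hN, hMN⟩ := h x.support
  convert hN.2 x using 1
  exact Finset.sum_congr rfl fun u hu => Finset.sum_congr rfl fun v hv => by
    simp only [hMN u hu v hv]

/-- The matrix of inner products of heads. -/
noncomputable def headInner : List (Letter A) → List (Letter A) → ℂ
  | x :: _, y :: _ => letterInner τ x y
  | _, _ => 0

theorem posSemidef_headInner :
    (Matrix.of fun u v : List (Letter A) => headInner τ u v).PosSemidef := by
  classical
  refine posSemidef_congr ?_ fun F => ?_
  · ext u v
    rcases u with _ | ⟨x, u⟩ <;> rcases v with _ | ⟨y, v⟩ <;>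
      simp [Matrix.conjTranspose_apply, headInner]
    exact conj_letterInner τ _ _
  · let G : Finset I := F.biUnion fun u => (u.head?.map Sigma.fst).toFinset
    refine ⟨_, Matrix.posSemidef_sum G fun i _ => posSemidef_headComp τ i, ?_⟩
    intro u hu v hv
    rw [Matrix.sum_apply]
    simp only [Matrix.of_apply]
    rcases u with _ | ⟨⟨i, a⟩, u⟩
    · simp [headInner, headComp]
    rcases v with _ | ⟨⟨j, b⟩, v⟩
    · simp [headInner, headComp]
    have hi : i ∈ G := Finset.mem_biUnion.2 ⟨_, hu, by simp⟩
    rw [Finset.sum_eq_single i]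
    · by_cases h : i = j
      · subst h
        simp [headInner, headComp, letterInner_same]
      · simp [headInner, headComp, letterInner, h, Ne.symm h]
    · intro k _ hk
      simp [headComp, Ne.symm hk]
    · exact fun h => absurd hi h

/-- `wordInner` with a bound on the length of the words. -/
noncomputable def wordInnerTrunc : ℕ → List (Letter A) → List (Letter A) → ℂ
  | 0, u, v => (if u = [] then 1 else 0) * (if v = [] then 1 else 0)
  | n + 1, u, v => (if u = [] then 1 else 0) * (if v = [] then 1 else 0) +
      headInner τ u v * wordInnerTrunc n u.tail v.tail

theorem wordInnerTrunc_eq : ∀ (n : ℕ) (u v : List (Letter A)), u.length ≤ n → v.length ≤ n →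
    wordInnerTrunc τ n u v = wordInner τ u v
  | 0, u, v, hu, hv => by
      simp only [Nat.le_zero, List.length_eq_zero_iff] at hu hv
      simp [hu, hv, wordInnerTrunc, wordInner]
  | n + 1, u, v, hu, hv => by
      rcases u with _ | ⟨x, u⟩ <;> rcases v with _ | ⟨y, v⟩ <;>
        simp [wordInnerTrunc, wordInner, headInner]
      left
      exact wordInnerTrunc_eq n u v (by simpa using hu) (by simpa using hv)

theorem posSemidef_nil : (Matrix.of fun u v : List (Letter A) =>
    ((if u = [] then 1 else 0) * (if v = [] then 1 else 0) : ℂ)).PosSemidef := by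
  refine ⟨?_, fun x => ?_⟩
  · ext u v
    by_cases hu : u = [] <;> by_cases hv : v = [] <;> simp [hu, hv]
  · have h := star_mul_self_nonneg (x.sum fun u c => c * (if u = [] then 1 else 0))
    convert h using 1
    simp only [Finsupp.sum, star_sum, Finset.sum_mul, Finset.mul_sum, Matrix.of_apply, star_mul]
    rw [Finset.sum_comm]
    refine Finset.sum_congr rfl fun u _ => Finset.sum_congr rfl fun v _ => ?_
    by_cases hu : u = [] <;> by_cases hv : v = [] <;> simp [hu, hv]

theorem posSemidef_wordInnerTrunc : ∀ n : ℕ,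
    (Matrix.of fun u v : List (Letter A) => wordInnerTrunc τ n u v).PosSemidef
  | 0 => posSemidef_nil
  | n + 1 => posSemidef_nil.add ((posSemidef_headInner τ).hadamard
      ((posSemidef_wordInnerTrunc n).submatrix List.tail))

theorem posSemidef_wordInner :
    (Matrix.of fun u v : List (Letter A) => wordInner τ u v).PosSemidef := by
  refine posSemidef_congr ?_ fun F => ?_
  · ext u v
    exact conj_wordInner τ v u
  · refine ⟨_, posSemidef_wordInnerTrunc τ (F.sup List.length), fun u hu v hv => ?_⟩
    simp only [Matrix.of_apply]
    rw [wordInnerTrunc_eq]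
    · exact Finset.le_sup (f := List.length) hu
    · exact Finset.le_sup (f := List.length) hv

end
end ReducedFreeProduct

namespace ReducedFreeProduct

/-- The vector space spanned by the alternating words. -/
def PreFock {I : Type*} {A : I → Type*} [∀ i, CStarAlgebra (A i)]
    (_τ : ∀ i, CStarState (A i)) := Word A →₀ ℂ

section
variable {I : Type*} {A : I → Type*} [∀ i, CStarAlgebra (A i)] (τ : ∀ i, CStarState (A i))

noncomputable instance : AddCommGroup (PreFock τ) := inferInstanceAs (AddCommGroup (Word A →₀ ℂ))
noncomputable instance : Module ℂ (PreFock τ) := inferInstanceAs (Module ℂ (Word A →₀ ℂ))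

/-- The semi-inner product on the span of the alternating words that extends `wordInner`. -/
noncomputable abbrev preFockCore : PreInnerProductSpace.Core ℂ (PreFock τ) where
  inner x y := Finsupp.sum x fun u c => Finsupp.sum y fun v d => conj c * wordInner τ u.1 v.1 * d
  conj_inner_symm x y := by
    simp only [Finsupp.sum, map_sum, map_mul, Complex.conj_conj, conj_wordInner]
    rw [Finset.sum_comm]
    refine Finset.sum_congr rfl fun u _ => Finset.sum_congr rfl fun v _ => ?_
    ring
  re_inner_nonneg x :=
    (Complex.nonneg_iff.1 (((posSemidef_wordInner τ).submatrix (Word.toList : Word A → _)).2 x)).1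
  add_left x y z := by
    refine Finsupp.sum_add_index' (fun _ => ?_) fun u c d => ?_
    · simp [Finsupp.sum]
    · simp [Finsupp.sum, add_mul, Finset.sum_add_distrib]
  smul_left x y r := by
    refine (Finsupp.sum_smul_index' (g := x) (b := r) fun _ => ?_).trans ?_
    · simp [Finsupp.sum]
    · simp [Finsupp.sum, Finset.mul_sum, mul_assoc]

noncomputable instance : SeminormedAddCommGroup (PreFock τ) :=
  InnerProductSpace.Core.toSeminormedAddCommGroup (c := preFockCore τ)
noncomputable instance : InnerProductSpace ℂ (PreFock τ) :=
  InnerProductSpace.ofCore (preFockCore τ)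

/-- The free product Hilbert space: the Hausdorff completion of the span of the alternating words.
It is the Hilbert space direct sum of `ℂ` (the empty word) and of the tensor products
`H°(i₁) ⊗ ⋯ ⊗ H°(iₘ)` with `i₁ ≠ i₂ ≠ ⋯ ≠ iₘ`, where `H°(i)` is the orthogonal complement of the
canonical vector in the GNS space of `(A i, τ i)`. -/
abbrev Fock := UniformSpace.Completion (PreFock τ)

/-- A word as a vector. -/
noncomputable def wordVec (τ : ∀ i, CStarState (A i)) (w : Word A) : PreFock τ :=
  Finsupp.single w (1 : ℂ)

theorem inner_wordVec (u v : Word A) :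
    ⟪wordVec τ u, wordVec τ v⟫_ℂ = wordInner τ u.1 v.1 := by
  change Finsupp.sum (Finsupp.single u (1:ℂ)) (fun u c => Finsupp.sum (Finsupp.single v (1:ℂ))
    fun v d => conj c * wordInner τ u.1 v.1 * d) = _
  simp

@[elab_as_elim]
theorem preFock_induction {p : PreFock τ → Prop} (x : PreFock τ) (h0 : p 0)
    (hadd : ∀ x y, p x → p y → p (x + y)) (hw : ∀ (c : ℂ) w, p (c • wordVec τ w)) : p x := by
  refine Finsupp.induction_linear x h0 hadd fun w c => ?_
  have : (Finsupp.single w c : Word A →₀ ℂ) = c • (Finsupp.single w 1 : Word A →₀ ℂ) := by simp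
  have h := hw c w
  change p (Finsupp.single w c : Word A →₀ ℂ)
  rw [this]; exact h

/-- The linear map on the span of the words with given values on the words. -/
noncomputable def liftWord {M : Type*} [AddCommGroup M] [Module ℂ M] (f : Word A → M) :
    PreFock τ →ₗ[ℂ] M := Finsupp.linearCombination ℂ f

@[simp] theorem liftWord_wordVec {M : Type*} [AddCommGroup M] [Module ℂ M] (f : Word A → M)
    (w : Word A) : liftWord τ f (wordVec τ w) = f w := by
  change Finsupp.linearCombination ℂ f (Finsupp.single w 1) = _
  simp

theorem coe_eq_of_inner {x y : PreFock τ} (h : ∀ w, ⟪wordVec τ w, x⟫_ℂ = ⟪wordVec τ w, y⟫_ℂ) :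
    (x : Fock τ) = y := by
  have h1 : ∀ z : PreFock τ, ⟪z, x⟫_ℂ = ⟪z, y⟫_ℂ := fun z => by
    induction z using preFock_induction with
    | h0 => simp
    | hadd a b ha hb => simp [inner_add_left, ha, hb]
    | hw c w => simp [inner_smul_left, h]
  have h2 : ∀ z : Fock τ, ⟪z, (x : Fock τ)⟫_ℂ = ⟪z, (y : Fock τ)⟫_ℂ := fun z => by
    induction z using UniformSpace.Completion.induction_on with
    | hp => apply isClosed_eq <;> fun_prop
    | ih z => simpa using h1 z
  exact ext_inner_left ℂ h2

/-- The centred leading letter of a word if its index is `i`, and `1` otherwise. -/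
noncomputable def lead (i : I) (w : Word A) : A i :=
  open Classical in
  match w.1 with
  | [] => 1
  | x :: _ => if h : x.1 = i then h ▸ (τ x.1).center x.2 else 1

open Classical in
/-- A list with its leading letter removed if the index of this letter is `i`. -/
noncomputable def restList (i : I) : List (Letter A) → List (Letter A)
  | [] => []
  | x :: l => if x.1 = i then l else x :: l

/-- A word with its leading letter removed if the index of this letter is `i`. -/
noncomputable def rest (i : I) (w : Word A) : Word A :=
  ⟨restList i w.1, by
    obtain ⟨l, hl⟩ := w
    rcases l with _ | ⟨x, l⟩
    · exact hl
    · simp only [restList]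
      split_ifs
      · exact hl.tail
      · exact hl⟩

theorem rest_head (i : I) (w : Word A) : ∀ x ∈ (rest i w).1.head?, x.1 ≠ i := by
  obtain ⟨l, hl⟩ := w
  rcases l with _ | ⟨x, l⟩
  · simp [rest, restList]
  · simp only [rest, restList]
    split_ifs with h
    · intro y hy
      rcases l with _ | ⟨z, l⟩
      · simp at hy
      · have := List.IsChain.rel hl
        simp at hy
        subst hy
        rw [← h]
        exact this.symm
    · simpa using h

/-- The word obtained from `w` by putting the letter `⟨i, a⟩` in front. -/
def consWord (i : I) (a : A i) (w : Word A) (h : ∀ x ∈ w.1.head?, x.1 ≠ i) : Word A :=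
  ⟨⟨i, a⟩ :: w.1, by
    obtain ⟨l, hl⟩ := w
    rcases l with _ | ⟨x, l⟩
    · simp
    · exact List.IsChain.cons_cons (by simpa using (h x (by simp)).symm) hl⟩

theorem lead_of_ne {i : I} {w : Word A} (h : ∀ x ∈ w.1.head?, x.1 ≠ i) : lead τ i w = 1 := by
  obtain ⟨l, hl⟩ := w
  rcases l with _ | ⟨x, l⟩
  · rfl
  · have : x.1 ≠ i := by simpa using h
    simp [lead, this]

theorem rest_of_ne {i : I} {w : Word A} (h : ∀ x ∈ w.1.head?, x.1 ≠ i) : rest i w = w := by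
  obtain ⟨l, hl⟩ := w
  rcases l with _ | ⟨x, l⟩
  · rfl
  · have : x.1 ≠ i := by simpa using h
    simp [rest, restList, this]

theorem lead_consWord (i : I) (a : A i) (w : Word A) (h) :
    lead τ i (consWord i a w h) = (τ i).center a := by
  simp [lead, consWord]

theorem rest_consWord (i : I) (a : A i) (w : Word A) (h) :
    rest i (consWord i a w h) = w := by
  simp [rest, consWord, restList]

theorem eq_consWord {i : I} {w : Word A} (h : ¬ ∀ x ∈ w.1.head?, x.1 ≠ i) :
    ∃ a w' h', w = consWord i a w' h' := by
  obtain ⟨l, hl⟩ := w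
  rcases l with _ | ⟨⟨j, a⟩, l⟩
  · simp at h
  · have hj : j = i := by simpa using h
    subst hj
    refine ⟨a, ⟨l, hl.tail⟩, ?_, rfl⟩
    have := rest_head j ⟨⟨j, a⟩ :: l, hl⟩
    simpa [rest, restList] using this

/-- Left multiplication by `a ∈ A i` on the span of the words. On a word `w` whose leading letter
does not have index `i` it is `a · w = τᵢ(a) w + (a - τᵢ(a)) w`; on a word `b w` with `b ∈ A i`
centred it is `a · b w = τᵢ(ab) w + (ab - τᵢ(ab)) w`. -/
noncomputable def leftMul (i : I) (a : A i) : PreFock τ →ₗ[ℂ] PreFock τ :=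
  liftWord τ fun w => τ i (a * lead τ i w) • wordVec τ (rest i w) +
    wordVec τ (consWord i (a * lead τ i w) (rest i w) (rest_head i w))

theorem leftMul_wordVec (i : I) (a : A i) (w : Word A) : leftMul τ i a (wordVec τ w) =
    τ i (a * lead τ i w) • wordVec τ (rest i w) +
      wordVec τ (consWord i (a * lead τ i w) (rest i w) (rest_head i w)) :=
  liftWord_wordVec _ _ _

theorem inner_consWord_left (i : I) (a : A i) (w v : Word A) (h)
    (hv : ∀ x ∈ v.1.head?, x.1 ≠ i) :
    wordInner τ (consWord i a w h).1 v.1 = 0 := by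
  rw [← conj_wordInner, consWord, wordInner_of_head_ne τ a hv]; simp

theorem inner_leftMul_wordVec (i : I) (a : A i) (v w : Word A) :
    ⟪wordVec τ v, leftMul τ i a (wordVec τ w)⟫_ℂ =
      τ i (star (lead τ i v) * (a * lead τ i w)) * wordInner τ (rest i v).1 (rest i w).1 := by
  rw [leftMul_wordVec, inner_add_right, inner_smul_right, inner_wordVec, inner_wordVec]
  by_cases hv : ∀ x ∈ v.1.head?, x.1 ≠ i
  · rw [lead_of_ne τ hv, rest_of_ne hv]
    simp only [consWord]
    rw [wordInner_of_head_ne τ _ hv]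
    simp
  · obtain ⟨b, v, h', rfl⟩ := eq_consWord hv
    rw [inner_consWord_left τ _ _ _ _ _ (rest_head i w), lead_consWord, rest_consWord]
    simp only [consWord, wordInner, letterInner_same, CStarState.map_star_center_mul_center]
    simp

theorem inner_leftMul_star (i : I) (a : A i) (x y : PreFock τ) :
    ⟪leftMul τ i (star a) x, y⟫_ℂ = ⟪x, leftMul τ i a y⟫_ℂ := by
  induction x using preFock_induction with
  | h0 => simp
  | hadd x x' hx hx' => simp [inner_add_left, hx, hx']
  | hw c v =>
    induction y using preFock_induction with
    | h0 => simp
    | hadd y y' hy hy' => simp only [map_add, inner_add_right, hy, hy']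
    | hw d w =>
      simp only [map_smul, inner_smul_left, inner_smul_right]
      rw [← inner_conj_symm, inner_leftMul_wordVec, inner_leftMul_wordVec, map_mul,
        conj_wordInner, CStarState.conj_star_mul]
      simp [mul_assoc]

theorem inner_leftMul_leftMul (i : I) (a b : A i) (v w : Word A) :
    ⟪wordVec τ v, leftMul τ i a (leftMul τ i b (wordVec τ w))⟫_ℂ =
      ⟪wordVec τ v, leftMul τ i (a * b) (wordVec τ w)⟫_ℂ := by
  rw [← inner_leftMul_star, leftMul_wordVec τ i (star a), inner_add_left, inner_smul_left,
    inner_leftMul_wordVec, inner_leftMul_wordVec, inner_leftMul_wordVec,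
    lead_of_ne τ (rest_head i v), rest_of_ne (rest_head i v), lead_consWord, rest_consWord,
    ← mul_assoc, ← add_mul]
  congr 1
  have := (τ i).map_star_mul_eq (star a * lead τ i v) (b * lead τ i w)
  rw [CStarState.map_star_center_mul_center] at this
  simp only [star_one, one_mul]
  rw [← this]
  simp [mul_assoc]

theorem inner_leftMul_one (i : I) (v w : Word A) :
    ⟪wordVec τ v, leftMul τ i 1 (wordVec τ w)⟫_ℂ = ⟪wordVec τ v, wordVec τ w⟫_ℂ := by
  rw [inner_leftMul_wordVec, inner_wordVec]
  by_cases hv : ∀ x ∈ v.1.head?, x.1 ≠ i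
  · rw [lead_of_ne τ hv, rest_of_ne hv]
    by_cases hw : ∀ x ∈ w.1.head?, x.1 ≠ i
    · rw [lead_of_ne τ hw, rest_of_ne hw]
      simp [CStarState.map_one']
    · obtain ⟨c, w, h', rfl⟩ := eq_consWord hw
      rw [lead_consWord]
      conv_rhs => rw [consWord, wordInner_of_head_ne τ c hv]
      simp [CStarState.map_center]
  · obtain ⟨b, v, h', rfl⟩ := eq_consWord hv
    rw [lead_consWord, rest_consWord]
    by_cases hw : ∀ x ∈ w.1.head?, x.1 ≠ i
    · rw [lead_of_ne τ hw, rest_of_ne hw, inner_consWord_left τ _ _ _ _ _ hw]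
      simp [CStarState.map_star, CStarState.map_center]
    · obtain ⟨c, w, h', rfl⟩ := eq_consWord hw
      rw [lead_consWord, rest_consWord]
      simp [consWord, wordInner, letterInner_same]

theorem coe_leftMul_eq {f g : PreFock τ →ₗ[ℂ] PreFock τ}
    (h : ∀ v w, ⟪wordVec τ v, f (wordVec τ w)⟫_ℂ = ⟪wordVec τ v, g (wordVec τ w)⟫_ℂ)
    (x : PreFock τ) : (f x : Fock τ) = g x := by
  refine coe_eq_of_inner τ fun v => ?_
  induction x using preFock_induction with
  | h0 => simp
  | hadd x y hx hy => simp only [map_add, inner_add_right, hx, hy]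
  | hw c w => simp only [map_smul, inner_smul_right, h]

theorem inner_leftMul_add (i : I) (a b : A i) (v w : Word A) :
    ⟪wordVec τ v, leftMul τ i (a + b) (wordVec τ w)⟫_ℂ =
      ⟪wordVec τ v, (leftMul τ i a + leftMul τ i b) (wordVec τ w)⟫_ℂ := by
  rw [LinearMap.add_apply, inner_add_right]
  simp only [inner_leftMul_wordVec, add_mul, mul_add, map_add]

theorem inner_leftMul_smul (i : I) (c : ℂ) (a : A i) (v w : Word A) :
    ⟪wordVec τ v, leftMul τ i (c • a) (wordVec τ w)⟫_ℂ =
      ⟪wordVec τ v, (c • leftMul τ i a) (wordVec τ w)⟫_ℂ := by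
  rw [LinearMap.smul_apply, inner_smul_right]
  simp only [inner_leftMul_wordVec, smul_mul_assoc, mul_smul_comm, map_smul, smul_eq_mul,
    mul_assoc]

theorem inner_eq_of_coe_eq {x y z : PreFock τ} (h : (x : Fock τ) = y) : ⟪z, x⟫_ℂ = ⟪z, y⟫_ℂ := by
  rw [← UniformSpace.Completion.inner_coe, h, UniformSpace.Completion.inner_coe]

theorem coe_leftMul_mul (i : I) (a b : A i) (x : PreFock τ) :
    (leftMul τ i (a * b) x : Fock τ) = leftMul τ i a (leftMul τ i b x) :=
  coe_leftMul_eq τ (g := leftMul τ i a ∘ₗ leftMul τ i b)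
    (fun v w => (inner_leftMul_leftMul τ i a b v w).symm) x

theorem coe_leftMul_one (i : I) (x : PreFock τ) : (leftMul τ i 1 x : Fock τ) = x :=
  coe_leftMul_eq τ (g := LinearMap.id) (inner_leftMul_one τ i) x

theorem coe_leftMul_add (i : I) (a b : A i) (x : PreFock τ) :
    (leftMul τ i (a + b) x : Fock τ) = ((leftMul τ i a x + leftMul τ i b x : PreFock τ) : Fock τ) :=
  coe_leftMul_eq τ (inner_leftMul_add τ i a b) x

theorem coe_leftMul_smul (i : I) (c : ℂ) (a : A i) (x : PreFock τ) :
    (leftMul τ i (c • a) x : Fock τ) = ((c • leftMul τ i a x : PreFock τ) : Fock τ) :=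
  coe_leftMul_eq τ (inner_leftMul_smul τ i c a) x

theorem exists_norm_sq_sub {B : Type*} [CStarAlgebra B] (a : B) :
    ∃ b : B, ((‖a‖ ^ 2 : ℝ) : ℂ) • (1 : B) = star a * a + star b * b := by
  let _ := CStarAlgebra.spectralOrder B
  let _ := CStarAlgebra.spectralOrderedRing B
  have h := CStarAlgebra.star_mul_le_algebraMap_norm_sq (a := a)
  rw [← sub_nonneg, CStarAlgebra.nonneg_iff_eq_star_mul_self] at h
  obtain ⟨b, hb⟩ := h
  refine ⟨b, ?_⟩
  rw [← hb, Algebra.algebraMap_eq_smul_one, add_sub_cancel]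
  exact Complex.coe_smul _ _

theorem norm_leftMul_le (i : I) (a : A i) (x : PreFock τ) : ‖leftMul τ i a x‖ ≤ ‖a‖ * ‖x‖ := by
  obtain ⟨b, hb⟩ := exists_norm_sq_sub a
  have key : ∀ c : A i, ⟪x, leftMul τ i (star c * c) x⟫_ℂ = ((‖leftMul τ i c x‖ ^ 2 : ℝ) : ℂ) := by
    intro c
    rw [inner_eq_of_coe_eq τ (coe_leftMul_mul τ i (star c) c x), ← inner_leftMul_star, star_star,
      inner_self_eq_norm_sq_to_K]
    simp
  have h1 : ⟪x, leftMul τ i (((‖a‖ ^ 2 : ℝ) : ℂ) • (1 : A i)) x⟫_ℂ =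
      ((‖a‖ ^ 2 * ‖x‖ ^ 2 : ℝ) : ℂ) := by
    rw [inner_eq_of_coe_eq τ (coe_leftMul_smul τ i _ 1 x), inner_smul_right,
      inner_eq_of_coe_eq τ (coe_leftMul_one τ i x), inner_self_eq_norm_sq_to_K]
    simp
  rw [hb, inner_eq_of_coe_eq τ (coe_leftMul_add τ i _ _ x), inner_add_right, key, key] at h1
  have h2 : ‖leftMul τ i a x‖ ^ 2 + ‖leftMul τ i b x‖ ^ 2 = ‖a‖ ^ 2 * ‖x‖ ^ 2 := by
    exact_mod_cast h1
  refine le_of_sq_le_sq ?_ (by positivity)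
  nlinarith [sq_nonneg ‖leftMul τ i b x‖]

/-- Left multiplication by `a ∈ A i` as a bounded operator on the span of the words. -/
noncomputable def leftMulL (i : I) (a : A i) : PreFock τ →L[ℂ] PreFock τ :=
  (leftMul τ i a).mkContinuous ‖a‖ (norm_leftMul_le τ i a)

@[simp] theorem leftMulL_apply (i : I) (a : A i) (x : PreFock τ) :
    leftMulL τ i a x = leftMul τ i a x := rfl

/-- The free product representation of `A i` on the free product Hilbert space. -/
noncomputable def rep (i : I) : A i →⋆ₐ[ℂ] (Fock τ →L[ℂ] Fock τ) where
  toFun a := (leftMulL τ i a).completion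
  map_one' := by
    ext x
    induction x using UniformSpace.Completion.induction_on with
    | hp => apply isClosed_eq <;> fun_prop
    | ih x => simpa using coe_leftMul_one τ i x
  map_mul' a b := by
    ext x
    induction x using UniformSpace.Completion.induction_on with
    | hp => apply isClosed_eq <;> fun_prop
    | ih x => simpa using coe_leftMul_mul τ i a b x
  map_zero' := by
    ext x
    induction x using UniformSpace.Completion.induction_on with
    | hp => apply isClosed_eq <;> fun_prop
    | ih x =>
      have h := coe_leftMul_smul τ i 0 0 x
      rw [zero_smul, zero_smul, UniformSpace.Completion.coe_zero] at h
      simpa using h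
  map_add' a b := by
    ext x
    induction x using UniformSpace.Completion.induction_on with
    | hp => apply isClosed_eq <;> fun_prop
    | ih x =>
      have h := coe_leftMul_add τ i a b x
      rw [UniformSpace.Completion.coe_add] at h
      simpa using h
  commutes' c := by
    ext x
    induction x using UniformSpace.Completion.induction_on with
    | hp => apply isClosed_eq <;> fun_prop
    | ih x =>
      have h1 := coe_leftMul_smul τ i c 1 x
      have h2 := coe_leftMul_one τ i x
      rw [UniformSpace.Completion.coe_smul, h2] at h1
      simpa [Algebra.algebraMap_eq_smul_one] using h1
  map_star' a := by
    refine (ContinuousLinearMap.eq_adjoint_iff _ _).mpr fun x y => ?_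
    induction x, y using UniformSpace.Completion.induction_on₂ with
    | hp => apply isClosed_eq <;> fun_prop
    | ih x y => simpa using inner_leftMul_star τ i a x y

theorem rep_coe (i : I) (a : A i) (x : PreFock τ) :
    rep τ i a (x : Fock τ) = (leftMul τ i a x : Fock τ) :=
  ContinuousLinearMap.completion_apply_coe _ _

/-- The vacuum vector: the empty word. -/
noncomputable def vacuum : Fock τ := (wordVec τ (⟨[], List.isChain_nil⟩ : Word A) : PreFock τ)

/-- The reduced free product as a concrete C⋆-algebra of operators: the norm closure of the
⋆-algebra generated by the images of the algebras `A i` on the free product Hilbert space. -/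
noncomputable def operatorAlgebra : StarSubalgebra ℂ (Fock τ →L[ℂ] Fock τ) :=
  (StarAlgebra.adjoin ℂ (⋃ i, Set.range (rep τ i))).topologicalClosure

instance : IsClosed (operatorAlgebra τ : Set (Fock τ →L[ℂ] Fock τ)) := isClosed_closure

end
end ReducedFreeProduct

open ReducedFreeProduct in
/-- The reduced free product `*ᵣ (A i, τ i)` of unital C⋆-algebras with given states. -/
abbrev ReducedFreeProduct {I : Type*} {A : I → Type*} [∀ i, CStarAlgebra (A i)]
    (τ : ∀ i, CStarState (A i)) : Type _ := operatorAlgebra τ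

namespace ReducedFreeProduct
section
variable {I : Type*} {A : I → Type*} [∀ i, CStarAlgebra (A i)] (τ : ∀ i, CStarState (A i))

theorem rep_mem (i : I) (a : A i) : rep τ i a ∈ operatorAlgebra τ :=
  StarSubalgebra.le_topologicalClosure _
    (StarAlgebra.subset_adjoin ℂ _ (Set.mem_iUnion.2 ⟨i, a, rfl⟩))

/-- The canonical homomorphism of a free factor to the reduced free product. -/
noncomputable def of (i : I) : A i →⋆ₐ[ℂ] ReducedFreeProduct τ :=
  (rep τ i).codRestrict (operatorAlgebra τ) (rep_mem τ i)

theorem norm_vacuum_sq : ⟪vacuum τ, vacuum τ⟫_ℂ = 1 := by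
  rw [vacuum, UniformSpace.Completion.inner_coe, inner_wordVec]; rfl

/-- The free product state: the vector state of the vacuum. -/
noncomputable def freeState : CStarState (ReducedFreeProduct τ) where
  toLinearMap :=
    { toFun := fun b => ⟪vacuum τ, (b : Fock τ →L[ℂ] Fock τ) (vacuum τ)⟫_ℂ
      map_add' := fun b c => by simp [inner_add_right]
      map_smul' := fun c b => by simp [inner_smul_right] }
  map_star_mul_self_nonneg b := by
    change 0 ≤ ⟪vacuum τ, (star (b : Fock τ →L[ℂ] Fock τ) * (b : Fock τ →L[ℂ] Fock τ))
      (vacuum τ)⟫_ℂ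
    rw [mul_apply_eq_comp, ContinuousLinearMap.star_eq_adjoint,
      ContinuousLinearMap.adjoint_inner_right]
    rw [inner_self_eq_norm_sq_to_K]
    positivity
  map_one := norm_vacuum_sq τ

end
end ReducedFreeProduct

namespace ReducedFreeProduct
section
variable {I J : Type*} {A : I → Type*} [∀ i, CStarAlgebra (A i)] (τ : ∀ i, CStarState (A i))
  (f : J ↪ I)

/-- Reindexing of a letter. -/
def mapLetter (x : Letter fun j => A (f j)) : Letter A := ⟨f x.1, x.2⟩

theorem letterInner_mapLetter (x y : Letter fun j => A (f j)) :
    letterInner τ (mapLetter f x) (mapLetter f y) = letterInner (fun j => τ (f j)) x y := by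
  obtain ⟨i, a⟩ := x
  obtain ⟨j, b⟩ := y
  by_cases h : i = j
  · subst h
    rw [letterInner_same, mapLetter, mapLetter, letterInner_same]
  · rw [letterInner_ne _ (fun h' => h (f.injective h')), letterInner_ne _ h]

/-- Words whose leading letter does not belong to the subfamily. -/
structure Tail where
  word : Word A
  head_ne : ∀ j, ∀ x ∈ word.1.head?, x.1 ≠ f j

/-- The empty word. -/
def Tail.nil : Tail (A := A) f := ⟨⟨[], List.isChain_nil⟩, fun _ _ h => by simp at h⟩

variable {f} in
/-- The concatenation of a word in the letters of the subfamily and a word of the whole family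
whose leading letter does not belong to the subfamily. -/
def concat (w : Tail (A := A) f) (u : Word fun j => A (f j)) : Word A :=
  ⟨u.1.map (mapLetter f) ++ w.1.1, by
    refine List.IsChain.append ?_ w.1.2 ?_
    · rw [List.isChain_map]
      exact u.2.imp fun x y h => by simpa [mapLetter] using h
    · intro x hx y hy
      rw [List.getLast?_map] at hx
      obtain ⟨z, _, rfl⟩ := Option.mem_map.1 hx
      exact (w.2 z.1 y hy).symm⟩

theorem wordInner_append {w v : List (Letter A)} (hw : ∀ j, ∀ x ∈ w.head?, x.1 ≠ f j)
    (hv : ∀ j, ∀ x ∈ v.head?, x.1 ≠ f j) : ∀ u u' : List (Letter fun j => A (f j)),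
    wordInner τ (u.map (mapLetter f) ++ w) (u'.map (mapLetter f) ++ v) =
      wordInner (fun j => τ (f j)) u u' * wordInner τ w v
  | [], [] => by simp [wordInner]
  | [], y :: u' => by
      simp only [wordInner, List.map_nil, List.nil_append, List.map_cons, List.cons_append,
        zero_mul]
      exact wordInner_of_head_ne τ (i := f y.1) y.2 (hw y.1)
  | x :: u, [] => by
      simp only [wordInner, List.map_nil, List.nil_append, List.map_cons, List.cons_append,
        zero_mul]
      rw [← conj_wordInner]
      have := wordInner_of_head_ne τ (i := f x.1) (v := u.map (mapLetter f) ++ w) x.2 (hv x.1)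
      simpa [mapLetter] using this
  | x :: u, y :: u' => by
      simp only [wordInner, List.map_cons, List.cons_append, letterInner_mapLetter,
        wordInner_append hw hv u u', mul_assoc]

variable {f} in
/-- Concatenation with a fixed word on the right, as a linear map. -/
noncomputable def rightConcat (w : Tail (A := A) f) :
    PreFock (fun j => τ (f j)) →ₗ[ℂ] PreFock τ :=
  liftWord _ fun u => wordVec τ (concat w u)

variable {f}

theorem rightConcat_wordVec (w : Tail (A := A) f) (u : Word fun j => A (f j)) :
    rightConcat τ w (wordVec _ u) = wordVec τ (concat w u) := liftWord_wordVec _ _ _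

theorem inner_rightConcat (w v : Tail (A := A) f) (x y : PreFock (fun j => τ (f j))) :
    ⟪rightConcat τ w x, rightConcat τ v y⟫_ℂ = ⟪x, y⟫_ℂ * wordInner τ w.1.1 v.1.1 := by
  induction x using preFock_induction with
  | h0 => simp
  | hadd x x' hx hx' => simp [inner_add_left, hx, hx', add_mul]
  | hw c u =>
    induction y using preFock_induction with
    | h0 => simp
    | hadd y y' hy hy' => simp only [map_add, inner_add_right, hy, hy', add_mul]
    | hw d u' =>
      simp only [map_smul, inner_smul_left, inner_smul_right, rightConcat_wordVec, inner_wordVec]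
      rw [concat, concat, wordInner_append τ f w.2 v.2]
      ring

theorem norm_rightConcat (w : Tail (A := A) f) (x : PreFock (fun j => τ (f j))) :
    ‖rightConcat τ w x‖ ≤ ‖wordVec τ w.1‖ * ‖x‖ := by
  refine le_of_sq_le_sq ?_ (by positivity)
  have h := inner_rightConcat τ w w x x
  rw [← inner_wordVec, inner_self_eq_norm_sq_to_K, inner_self_eq_norm_sq_to_K,
    inner_self_eq_norm_sq_to_K] at h
  have h' : ‖rightConcat τ w x‖ ^ 2 = ‖x‖ ^ 2 * ‖wordVec τ w.1‖ ^ 2 := by exact_mod_cast h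
  rw [h', mul_pow, mul_comm]

/-- Concatenation with a fixed word on the right, as an operator between the free product Hilbert
spaces of the subfamily and of the whole family. -/
noncomputable def concatL (w : Tail (A := A) f) : Fock (fun j => τ (f j)) →L[ℂ] Fock τ :=
  ((rightConcat τ w).mkContinuous _ (norm_rightConcat τ w)).completion

theorem concatL_coe (w : Tail (A := A) f) (x : PreFock fun j => τ (f j)) :
    concatL τ w (x : Fock _) = (rightConcat τ w x : Fock τ) :=
  ContinuousLinearMap.completion_apply_coe _ _

theorem inner_concatL (w v : Tail (A := A) f) (x y : Fock (fun j => τ (f j))) :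
    ⟪concatL τ w x, concatL τ v y⟫_ℂ = ⟪x, y⟫_ℂ * wordInner τ w.1.1 v.1.1 := by
  induction x, y using UniformSpace.Completion.induction_on₂ with
  | hp => apply isClosed_eq <;> fun_prop
  | ih x y => simpa [concatL_coe] using inner_rightConcat τ w v x y

theorem leftMul_rightConcat (w : Tail (A := A) f) (j : J) (a : A (f j))
    (x : PreFock fun j => τ (f j)) :
    leftMul τ (f j) a (rightConcat τ w x) =
      rightConcat τ w (leftMul (fun j => τ (f j)) j a x) := by
  induction x using preFock_induction with
  | h0 => simp
  | hadd x y hx hy => simp only [map_add, hx, hy]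
  | hw c u =>
    simp only [map_smul]
    congr 1
    rw [rightConcat_wordVec, leftMul_wordVec, leftMul_wordVec, map_add, map_smul,
      rightConcat_wordVec, rightConcat_wordVec]
    by_cases hu : ∀ x ∈ u.1.head?, x.1 ≠ j
    · have hc : ∀ x ∈ (concat w u).1.head?, x.1 ≠ f j := by
        obtain ⟨u, h⟩ := u
        rcases u with _ | ⟨x, u⟩
        · simpa [concat] using w.2 j
        · simpa [concat, mapLetter] using hu
      simp only [lead_of_ne _ hc, lead_of_ne _ hu, rest_of_ne hc, rest_of_ne hu]
      congr 2
    · obtain ⟨b, u, h', rfl⟩ := eq_consWord hu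
      have hc : ∀ x ∈ (concat w u).1.head?, x.1 ≠ f j := by
        obtain ⟨u, h⟩ := u
        rcases u with _ | ⟨x, u⟩
        · simpa [concat] using w.2 j
        · simpa [concat, mapLetter] using h'
      have hcc : concat w (consWord j b u h') = consWord (f j) b (concat w u) hc := rfl
      simp only [hcc, lead_consWord, rest_consWord]
      congr 2

theorem rep_concatL (w : Tail (A := A) f) (j : J) (a : A (f j)) :
    rep τ (f j) a ∘L concatL τ w = concatL τ w ∘L rep (fun j => τ (f j)) j a := by
  ext x
  induction x using UniformSpace.Completion.induction_on with
  | hp => apply isClosed_eq <;> fun_prop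
  | ih x =>
    simp only [ContinuousLinearMap.comp_apply, concatL_coe, rep_coe, leftMul_rightConcat]

theorem exists_concat (l : List (Letter A)) (hl : l.IsChain (fun x y => x.1 ≠ y.1)) :
    ∃ (w : Tail (A := A) f) (u : Word fun j => A (f j)), (concat w u).1 = l := by
  induction l with
  | nil => exact ⟨Tail.nil f, ⟨[], List.isChain_nil⟩, rfl⟩
  | cons x l ih =>
    by_cases hx : ∃ j, f j = x.1
    · obtain ⟨w, u, rfl⟩ := ih hl.tail
      obtain ⟨i, a⟩ := x
      obtain ⟨j, rfl⟩ := hx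
      refine ⟨w, ⟨⟨j, a⟩ :: u.1, ?_⟩, rfl⟩
      obtain ⟨u, hu⟩ := u
      rcases u with _ | ⟨y, u⟩
      · simp
      · refine List.IsChain.cons_cons ?_ hu
        have h : f j ≠ f y.1 := by simpa [concat, mapLetter] using (List.isChain_cons_cons.1 hl).1
        exact fun h' => h (congrArg f h')
    · refine ⟨⟨⟨x :: l, hl⟩, ?_⟩, ⟨[], List.isChain_nil⟩, rfl⟩
      intro j y hy
      have : y = x := by simpa using hy.symm
      subst this
      exact fun h => hx ⟨j, h.symm⟩

theorem ext_concatL {E : Type*} [NormedAddCommGroup E] [NormedSpace ℂ E] {S T : Fock τ →L[ℂ] E}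
    (h : ∀ w : Tail (A := A) f, S ∘L concatL τ w = T ∘L concatL τ w) : S = T := by
  ext x
  induction x using UniformSpace.Completion.induction_on with
  | hp => apply isClosed_eq <;> fun_prop
  | ih x =>
    induction x using preFock_induction with
    | h0 => rw [UniformSpace.Completion.coe_zero, map_zero, map_zero]
    | hadd x y hx hy => simp only [UniformSpace.Completion.coe_add, map_add, hx, hy]
    | hw c w =>
      simp only [UniformSpace.Completion.coe_smul, map_smul]
      obtain ⟨v, u, hu⟩ := exists_concat (f := f) w.1 w.2
      obtain rfl : concat v u = w := Word.ext hu
      have := DFunLike.congr_fun (h v) (wordVec (fun j => τ (f j)) u : Fock fun j => τ (f j))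
      simp only [ContinuousLinearMap.comp_apply, concatL_coe, rightConcat_wordVec] at this
      rw [this]

variable (f)

/-- The canonical isometry from the free product Hilbert space of the subfamily. -/
noncomputable def fockIncl : Fock (fun j => τ (f j)) →L[ℂ] Fock τ :=
  concatL τ (Tail.nil f)

theorem adjoint_fockIncl_comp : (fockIncl τ f).adjoint ∘L fockIncl τ f = 1 := by
  ext x
  refine ext_inner_left ℂ fun y => ?_
  rw [ContinuousLinearMap.comp_apply, ContinuousLinearMap.adjoint_inner_right, fockIncl,
    inner_concatL]
  simp [wordInner, Tail.nil]

/-- The compression of an operator to the free product Hilbert space of the subfamily. -/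
noncomputable def compress (T : Fock τ →L[ℂ] Fock τ) :
    Fock (fun j => τ (f j)) →L[ℂ] Fock (fun j => τ (f j)) :=
  (fockIncl τ f).adjoint ∘L T ∘L fockIncl τ f

theorem compress_adjoint (T : Fock τ →L[ℂ] Fock τ) :
    compress τ f (star T) = star (compress τ f T) := by
  simp only [compress, ContinuousLinearMap.star_eq_adjoint, ContinuousLinearMap.adjoint_comp,
    ContinuousLinearMap.adjoint_adjoint, ContinuousLinearMap.comp_assoc]

/-- The operators of the form `x ⊗ 1` in the decomposition of the free product Hilbert space of the
whole family as a tensor product with the one of the subfamily as the first factor. -/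
def IsAmpl (T : Fock τ →L[ℂ] Fock τ) : Prop :=
  ∀ w : Tail (A := A) f, T ∘L concatL τ w = concatL τ w ∘L compress τ f T

variable {τ f}

theorem isAmpl_of {T : Fock τ →L[ℂ] Fock τ}
    {x : Fock (fun j => τ (f j)) →L[ℂ] Fock (fun j => τ (f j))}
    (h : ∀ w : Tail (A := A) f, T ∘L concatL τ w = concatL τ w ∘L x) :
    compress τ f T = x ∧ IsAmpl τ f T := by
  have hx : compress τ f T = x := by
    rw [compress, fockIncl, h (Tail.nil f), ← ContinuousLinearMap.comp_assoc]
    have := adjoint_fockIncl_comp τ f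
    rw [fockIncl] at this
    rw [this]; rfl
  exact ⟨hx, fun w => by rw [hx]; exact h w⟩

theorem isAmpl_rep (j : J) (a : A (f j)) : compress τ f (rep τ (f j) a) =
    rep (fun j => τ (f j)) j a ∧ IsAmpl τ f (rep τ (f j) a) :=
  isAmpl_of fun w => rep_concatL τ w j a

theorem IsAmpl.mul {S T : Fock τ →L[ℂ] Fock τ} (hS : IsAmpl τ f S) (hT : IsAmpl τ f T) :
    compress τ f (S * T) = compress τ f S * compress τ f T ∧ IsAmpl τ f (S * T) := by
  refine isAmpl_of fun w => ?_
  change (S ∘L T) ∘L _ = _ ∘L (_ ∘L _)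
  rw [ContinuousLinearMap.comp_assoc, hT w, ← ContinuousLinearMap.comp_assoc, hS w,
    ContinuousLinearMap.comp_assoc]

theorem IsAmpl.add {S T : Fock τ →L[ℂ] Fock τ} (hS : IsAmpl τ f S) (hT : IsAmpl τ f T) :
    compress τ f (S + T) = compress τ f S + compress τ f T ∧ IsAmpl τ f (S + T) := by
  refine isAmpl_of fun w => ?_
  rw [ContinuousLinearMap.add_comp, ContinuousLinearMap.comp_add, hS w, hT w]

theorem isAmpl_algebraMap (c : ℂ) : compress τ f (algebraMap ℂ _ c) = algebraMap ℂ _ c ∧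
    IsAmpl τ f (algebraMap ℂ _ c) := by
  refine isAmpl_of fun w => ?_
  ext x
  simp [Algebra.algebraMap_eq_smul_one]

theorem isAmpl_star {T : Fock τ →L[ℂ] Fock τ} (hT : IsAmpl τ f T) :
    IsAmpl τ f (star T) := by
  have key : ∀ w v : Tail (A := A) f,
      (concatL τ v).adjoint ∘L (star T) ∘L concatL τ w =
        (concatL τ v).adjoint ∘L concatL τ w ∘L compress τ f (star T) := by
    intro w v
    ext x
    refine ext_inner_left ℂ fun y => ?_
    simp only [ContinuousLinearMap.comp_apply, ContinuousLinearMap.adjoint_inner_right]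
    rw [ContinuousLinearMap.star_eq_adjoint, ContinuousLinearMap.adjoint_inner_right,
      ← ContinuousLinearMap.star_eq_adjoint]
    have := DFunLike.congr_fun (hT v) y
    simp only [ContinuousLinearMap.comp_apply] at this
    rw [this, inner_concatL, inner_concatL, compress_adjoint,
      ContinuousLinearMap.star_eq_adjoint, ContinuousLinearMap.adjoint_inner_right]
  intro w
  have h2 : (star T ∘L concatL τ w).adjoint =
      (concatL τ w ∘L compress τ f (star T)).adjoint := by
    refine ext_concatL (f := f) τ fun v => ?_
    have := congrArg ContinuousLinearMap.adjoint (key w v)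
    simpa only [ContinuousLinearMap.adjoint_comp, ContinuousLinearMap.adjoint_adjoint,
      ContinuousLinearMap.comp_assoc] using this
  have := congrArg ContinuousLinearMap.adjoint h2
  simpa only [ContinuousLinearMap.adjoint_adjoint] using this

variable (τ f)

theorem isClosed_isAmpl : IsClosed {T : Fock τ →L[ℂ] Fock τ | IsAmpl τ f T} := by
  simp only [IsAmpl, Set.ofPred_forall]
  refine isClosed_iInter fun w => isClosed_eq ?_ ?_
  · fun_prop
  · unfold compress; fun_prop

/-- The operators of the reduced free product of the whole family that are of the form
`x ⊗ 1`. -/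
noncomputable def ampl : StarSubalgebra ℂ (Fock τ →L[ℂ] Fock τ) where
  carrier := {T | T ∈ operatorAlgebra τ ∧ IsAmpl τ f T}
  mul_mem' h h' := ⟨mul_mem h.1 h'.1, (h.2.mul h'.2).2⟩
  add_mem' h h' := ⟨add_mem h.1 h'.1, (h.2.add h'.2).2⟩
  algebraMap_mem' c := ⟨algebraMap_mem _ c, (isAmpl_algebraMap c).2⟩
  star_mem' h := ⟨star_mem h.1, isAmpl_star h.2⟩

instance : IsClosed (ampl τ f : Set (Fock τ →L[ℂ] Fock τ)) :=
  IsClosed.inter (isClosed_closure : IsClosed (operatorAlgebra τ : Set (Fock τ →L[ℂ] Fock τ))) (isClosed_isAmpl τ f)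

/-- The compression is a ⋆-homomorphism on the operators of the form `x ⊗ 1`. -/
noncomputable def compressHom :
    ampl τ f →⋆ₐ[ℂ] (Fock (fun j => τ (f j)) →L[ℂ] Fock (fun j => τ (f j))) where
  toFun T := compress τ f T.1
  map_one' := by simpa using (isAmpl_algebraMap (τ := τ) (f := f) 1).1
  map_zero' := by simpa using (isAmpl_algebraMap (τ := τ) (f := f) 0).1
  map_mul' S T := (S.2.2.mul T.2.2).1
  map_add' S T := (S.2.2.add T.2.2).1
  commutes' c := (isAmpl_algebraMap c).1
  map_star' T := compress_adjoint τ f T.1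

theorem compressHom_injective : Function.Injective (compressHom τ f) := by
  intro S T h
  have h' : compress τ f S.1 = compress τ f T.1 := h
  refine Subtype.ext (ext_concatL (f := f) τ fun w => ?_)
  rw [S.2.2 w, T.2.2 w, h']

theorem operatorAlgebra_le_range :
    operatorAlgebra (fun j => τ (f j)) ≤ (compressHom τ f).range := by
  have hcl : IsClosed ((compressHom τ f).range : Set
      (Fock (fun j => τ (f j)) →L[ℂ] Fock (fun j => τ (f j)))) := by
    exact (NonUnitalStarAlgHom.isometry (compressHom τ f)
      (compressHom_injective τ f)).isClosedEmbedding.isClosed_range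
  refine StarSubalgebra.topologicalClosure_minimal (StarAlgebra.adjoin_le ?_) hcl
  rintro _ ⟨_, ⟨j, rfl⟩, a, rfl⟩
  exact ⟨⟨rep τ (f j) a, rep_mem τ (f j) a, (isAmpl_rep j a).2⟩, (isAmpl_rep j a).1⟩

/-- The inclusion of the reduced free product of a subfamily in the reduced free product of the
whole family. It is the ⋆-homomorphism `x ↦ x ⊗ 1`, the inverse of the compression, and it is
determined by its values on the free factors, see `incl_of`. -/
noncomputable def incl : ReducedFreeProduct (fun j => τ (f j)) →⋆ₐ[ℂ] ReducedFreeProduct τ :=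
  (StarSubalgebra.inclusion (S₁ := ampl τ f) (S₂ := operatorAlgebra τ) fun _ h => h.1).comp
    (((StarAlgEquiv.ofInjective (compressHom τ f)
      (compressHom_injective τ f)).symm : (compressHom τ f).range →⋆ₐ[ℂ] ampl τ f).comp
      (StarSubalgebra.inclusion (operatorAlgebra_le_range τ f)))

theorem incl_of (j : J) (a : A (f j)) :
    incl τ f (of (fun j => τ (f j)) j a) = of τ (f j) a := by
  let T : ampl τ f := ⟨rep τ (f j) a, rep_mem τ (f j) a, (isAmpl_rep j a).2⟩
  have hT : StarSubalgebra.inclusion (operatorAlgebra_le_range τ f)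
      (of (fun j => τ (f j)) j a) =
      StarAlgEquiv.ofInjective (compressHom τ f) (compressHom_injective τ f) T :=
    Subtype.ext (isAmpl_rep j a).1.symm
  have h2 : ((StarAlgEquiv.ofInjective (compressHom τ f) (compressHom_injective τ f)).symm
      (StarSubalgebra.inclusion (operatorAlgebra_le_range τ f)
      (of (fun j => τ (f j)) j a))) = T := by
    rw [hT, StarAlgEquiv.symm_apply_apply]
  change StarSubalgebra.inclusion (S₁ := ampl τ f) (S₂ := operatorAlgebra τ) (fun _ h => h.1)
    ((StarAlgEquiv.ofInjective (compressHom τ f) (compressHom_injective τ f)).symm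
      (StarSubalgebra.inclusion (operatorAlgebra_le_range τ f)
      (of (fun j => τ (f j)) j a))) = _
  rw [h2]
  rfl

end
end ReducedFreeProduct

namespace CStarDirectLimit
section
variable {A : ℕ → Type*} [∀ n, CStarAlgebra (A n)] (α : ∀ n, A n →⋆ₐ[ℂ] A (n + 1))

/-- The sequences that from some point on follow the connecting maps of the direct system. -/
def threadAlgebra : StarSubalgebra ℂ (∀ n, A n) where
  carrier := {x | ∀ᶠ n in Filter.atTop, x (n + 1) = α n (x n)}
  mul_mem' h h' := by filter_upwards [h, h'] with n hn hn'; simp [hn, hn']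
  add_mem' h h' := by filter_upwards [h, h'] with n hn hn'; simp [hn, hn']
  algebraMap_mem' c := by
    refine Filter.Eventually.of_forall fun n => ?_
    exact (AlgHomClass.commutes (α n) c).symm
  star_mem' h := by filter_upwards [h] with n hn; simp [hn, map_star]

/-- The sequences that from some point on follow the connecting maps. Modulo the sequences that
are eventually zero, this is the algebraic direct limit. -/
def Thread : Type _ := threadAlgebra α

noncomputable instance : Ring (Thread α) := inferInstanceAs (Ring (threadAlgebra α))
noncomputable instance : StarRing (Thread α) := inferInstanceAs (StarRing (threadAlgebra α))
noncomputable instance : Algebra ℂ (Thread α) := inferInstanceAs (Algebra ℂ (threadAlgebra α))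
noncomputable instance : StarModule ℂ (Thread α) :=
  inferInstanceAs (StarModule ℂ (threadAlgebra α))

/-- Evaluation of a thread. -/
def Thread.eval {α : ∀ n, A n →⋆ₐ[ℂ] A (n + 1)} (x : Thread α) (n : ℕ) : A n := x.1 n

theorem Thread.eventually {α : ∀ n, A n →⋆ₐ[ℂ] A (n + 1)} (x : Thread α) :
    ∀ᶠ n in Filter.atTop, x.eval (n + 1) = α n (x.eval n) := x.2

/-- The seminorm of the direct limit: `‖x‖ = lim ‖x n‖`. -/
noncomputable instance : Norm (Thread α) :=
  ⟨fun x => Filter.limsup (fun n => ‖x.eval n‖) Filter.atTop⟩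

variable {α}

theorem Thread.tendsto_norm (x : Thread α) :
    Filter.Tendsto (fun n => ‖x.eval n‖) Filter.atTop (nhds ‖x‖) := by
  obtain ⟨N, hN⟩ := Filter.eventually_atTop.1 x.eventually
  have hanti : Antitone fun n => ‖x.eval (n + N)‖ := antitone_nat_of_succ_le fun n => by
    have := hN (n + N) (by omega)
    rw [show n + 1 + N = n + N + 1 by omega, this]
    exact NonUnitalStarAlgHom.norm_apply_le (α (n + N)) _
  have h := tendsto_atTop_ciInf hanti ⟨0, by rintro _ ⟨n, rfl⟩; positivity⟩
  have h2 := (Filter.tendsto_add_atTop_iff_nat (f := fun n => ‖x.eval n‖) N).1 h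
  have h3 : ‖x‖ = _ := h2.limsup_eq
  rw [h3]
  exact h2

variable (α)

noncomputable instance : SeminormedRing (Thread α) where
  __ := (inferInstance : Ring (Thread α))
  __ := SeminormedAddCommGroup.ofCore (𝕜 := ℂ) (E := Thread α)
    { norm_nonneg := fun x => ge_of_tendsto' x.tendsto_norm fun _ => norm_nonneg _
      norm_smul := fun c x => tendsto_nhds_unique (c • x).tendsto_norm
        ((x.tendsto_norm.const_mul ‖c‖).congr fun n => (norm_smul c (x.eval n)).symm)
      norm_triangle := fun x y => le_of_tendsto_of_tendsto' (x + y).tendsto_norm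
        (x.tendsto_norm.add y.tendsto_norm) fun n => norm_add_le (x.eval n) (y.eval n) }
  norm_mul_le x y := le_of_tendsto_of_tendsto' (x * y).tendsto_norm
        (x.tendsto_norm.mul y.tendsto_norm) fun n => norm_mul_le (x.eval n) (y.eval n)

noncomputable instance : NormedAlgebra ℂ (Thread α) where
  norm_smul_le c x := (tendsto_nhds_unique (c • x).tendsto_norm
        ((x.tendsto_norm.const_mul ‖c‖).congr fun n => (norm_smul c (x.eval n)).symm)).le

theorem norm_star_thread (x : Thread α) : ‖star x‖ = ‖x‖ :=
  tendsto_nhds_unique (star x).tendsto_norm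
    (x.tendsto_norm.congr fun n => (norm_star (x.eval n)).symm)

theorem norm_mul_self_thread (x : Thread α) : ‖x‖ * ‖x‖ = ‖star x * x‖ :=
  tendsto_nhds_unique (x.tendsto_norm.mul x.tendsto_norm)
    ((star x * x).tendsto_norm.congr fun n => CStarRing.norm_star_mul_self (x := x.eval n))

theorem isometry_star_thread : Isometry (star : Thread α → Thread α) :=
  Isometry.of_dist_eq fun x y => by
    rw [dist_eq_norm, dist_eq_norm, ← star_sub, norm_star_thread]

end
end CStarDirectLimit

open CStarDirectLimit in
/-- The C⋆-algebraic direct limit of a sequence of unital C⋆-algebras and unital ⋆-homomorphisms: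
the Hausdorff completion of the algebraic direct limit in the seminorm `lim ‖x n‖`. -/
def CStarDirectLimit {A : ℕ → Type*} [∀ n, CStarAlgebra (A n)]
    (α : ∀ n, A n →⋆ₐ[ℂ] A (n + 1)) : Type _ := UniformSpace.Completion (Thread α)

namespace CStarDirectLimit
open UniformSpace
section
variable {A : ℕ → Type*} [∀ n, CStarAlgebra (A n)] (α : ∀ n, A n →⋆ₐ[ℂ] A (n + 1))

noncomputable instance : NormedRing (CStarDirectLimit α) :=
  inferInstanceAs (NormedRing (Completion (Thread α)))

instance : CompleteSpace (CStarDirectLimit α) :=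
  inferInstanceAs (CompleteSpace (Completion (Thread α)))

noncomputable instance : Algebra ℂ (CStarDirectLimit α) :=
  inferInstanceAs (Algebra ℂ (Completion (Thread α)))

noncomputable instance : NormedAlgebra ℂ (CStarDirectLimit α) where
  norm_smul_le c x := norm_smul_le (β := Completion (Thread α)) c x

/-- The adjoint is extended by continuity. -/
noncomputable instance : Star (CStarDirectLimit α) :=
  ⟨Completion.map (star : Thread α → Thread α)⟩

theorem coe_star (x : Thread α) :
    ((star x : Thread α) : Completion (Thread α)) =
      (star (show CStarDirectLimit α from (x : Completion (Thread α))) : CStarDirectLimit α) :=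
  (Completion.map_coe (isometry_star_thread α).uniformContinuous x).symm

theorem continuous_star_aux : Continuous (star : CStarDirectLimit α → CStarDirectLimit α) :=
  Completion.continuous_map

noncomputable instance : StarRing (CStarDirectLimit α) where
  star_involutive x := by
    refine Completion.induction_on (p := fun x : CStarDirectLimit α => star (star x) = x) x ?_ ?_
    · exact isClosed_eq ((continuous_star_aux α).comp (continuous_star_aux α)) continuous_id
    · intro a
      rw [← coe_star, ← coe_star, star_star]
  star_mul x y := by
    refine Completion.induction_on₂
      (p := fun x y : CStarDirectLimit α => star (x * y) = star y * star x) x y ?_ ?_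
    · exact isClosed_eq ((continuous_star_aux α).comp continuous_mul)
        (((continuous_star_aux α).comp continuous_snd).mul
          ((continuous_star_aux α).comp continuous_fst))
    · intro a b
      rw [← coe_star, ← coe_star]
      refine (congrArg (star : CStarDirectLimit α → CStarDirectLimit α) (Completion.coe_mul a b).symm).trans ?_
      refine (coe_star α (a * b)).symm.trans ?_
      rw [star_mul]
      exact Completion.coe_mul _ _
  star_add x y := by
    refine Completion.induction_on₂
      (p := fun x y : CStarDirectLimit α => star (x + y) = star x + star y) x y ?_ ?_
    · exact isClosed_eq ((continuous_star_aux α).comp continuous_add)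
        (((continuous_star_aux α).comp continuous_fst).add
          ((continuous_star_aux α).comp continuous_snd))
    · intro a b
      rw [← coe_star, ← coe_star]
      refine (congrArg (star : CStarDirectLimit α → CStarDirectLimit α) (Completion.coe_add a b).symm).trans ?_
      refine (coe_star α (a + b)).symm.trans ?_
      rw [star_add]
      exact Completion.coe_add _ _

noncomputable instance : CStarAlgebra (CStarDirectLimit α) where
  norm_mul_self_le x := by
    refine Completion.induction_on
      (p := fun x : CStarDirectLimit α => ‖x‖ * ‖x‖ ≤ ‖star x * x‖) x ?_ ?_
    · exact isClosed_le (continuous_norm.mul continuous_norm)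
        (continuous_norm.comp ((continuous_star_aux α).mul continuous_id))
    · intro a
      rw [← coe_star]
      have h1 : ‖((a : Completion (Thread α)) : Completion (Thread α))‖ = ‖a‖ :=
        Completion.norm_coe a
      have h2 : ‖((star a : Thread α) : Completion (Thread α)) * (a : Completion (Thread α))‖ =
          ‖star a * a‖ := by rw [← Completion.coe_mul, Completion.norm_coe]
      exact (congrArg₂ (· * ·) h1 h1).le.trans ((norm_mul_self_thread α a).le.trans h2.ge)
  star_smul c x := by
    refine Completion.induction_on
      (p := fun x : CStarDirectLimit α => star (c • x) = star c • star x) x ?_ ?_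
    · exact isClosed_eq ((continuous_star_aux α).comp
          (continuous_const_smul c : Continuous fun x : CStarDirectLimit α => c • x))
        ((continuous_const_smul (star c) :
          Continuous fun x : CStarDirectLimit α => star c • x).comp (continuous_star_aux α))
    · intro a
      rw [← coe_star]
      refine (congrArg (star : CStarDirectLimit α → CStarDirectLimit α) (Completion.coe_smul c a).symm).trans ?_
      refine (coe_star α (c • a)).symm.trans ?_
      rw [star_smul]
      exact Completion.coe_smul _ _

end
end CStarDirectLimit

/-- The reduced free product of the first `n + 1` members of a sequence. -/
abbrev FirstFreeProduct {A : ℕ → Type*} [∀ k, CStarAlgebra (A k)] (τ : ∀ k, CStarState (A k))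
    (n : ℕ) : Type _ :=
  ReducedFreeProduct (fun k : Fin (n + 1) => τ k)

/-- The inclusion of the reduced free product of the first `n + 1` members of a sequence in the
reduced free product of the first `n + 2` members, as the first `n + 1` free factors. -/
noncomputable def FirstFreeProduct.incl {A : ℕ → Type*} [∀ k, CStarAlgebra (A k)]
    (τ : ∀ k, CStarState (A k)) (n : ℕ) : FirstFreeProduct τ n →⋆ₐ[ℂ] FirstFreeProduct τ (n + 1) :=
  ReducedFreeProduct.incl (fun k : Fin (n + 1 + 1) => τ k) Fin.castSuccEmb

/-- The canonical state of the reduced free product of the first `n + 1` members of a sequence. -/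
noncomputable def FirstFreeProduct.state {A : ℕ → Type*} [∀ k, CStarAlgebra (A k)]
    (τ : ∀ k, CStarState (A k)) (n : ℕ) : CStarState (FirstFreeProduct τ n) :=
  ReducedFreeProduct.freeState (fun k : Fin (n + 1) => τ k)

/-! The twist is undone by an isomorphism of direct systems. Suppose that every state preserving
automorphism `σ` of `B_n` extends along `ι_n` to a state preserving automorphism `β` of `B_{n+1}`.
Put `σ_0 = id` and `σ_{n+1} = β_n ∘ γ_{n+1}⁻¹`, where `β_n` extends `σ_n`. Then `σ_{n+1} ∘ (γ_{n+1}
∘ ι_n) = β_n ∘ ι_n = ι_n ∘ σ_n`, so the `σ_n` carry the twisted system to the untwisted one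
(`CStarDirectLimit.nonempty_equiv_of_extension`).

The extension is the free product `σ * id` of `σ` with the identity of the new factor. It is
obtained from the uniqueness of free realizations. On the Fock space of `B_{n+1}` the pair
consisting of `B_n` and the new algebra acts in two ways: by the canonical representations, and with
`B_n` twisted by `σ`. Since `σ` preserves the state, both actions are free with respect to the
vacuum (`isFreeRealization_twistedPair`), and in both the vacuum is cyclic
(`denseRange_realize_twistedPair`). Freeness determines all inner products of alternating products
of centred elements applied to the vacuum (`IsFreeRealization.inner_wordProd`), so a unitary that
fixes the vacuum intertwines the two actions (`IsFreeRealization.exists_intertwiner`). Conjugation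
by it maps the generated algebra onto itself and is the required automorphism
(`ReducedFreeProduct.exists_extension`).

The words in the pair serve only as a common model of the two actions, so `B_{n+1}` need not be
identified with a reduced free product of two algebras. Faithfulness of the states plays no role. -/

namespace ReducedFreeProduct

/-! ### Free realizations and their uniqueness -/

theorem head_ne_of_isChain_cons {I : Type*} {A : I → Type*} {x : Letter A} {l : List (Letter A)}
    (h : (x :: l).IsChain (fun x y => x.1 ≠ y.1)) : ∀ y ∈ l.head?, y.1 ≠ x.1 := by
  intro y hy
  cases l with
  | nil => simp at hy
  | cons z l =>
    obtain rfl : z = y := by simpa using hy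
    exact (List.isChain_cons_cons.1 h).1.symm

section
variable {K : Type*} {C : K → Type*} [∀ k, CStarAlgebra (C k)] (σ : ∀ k, CStarState (C k))
  {E : Type*} [NormedAddCommGroup E] [InnerProductSpace ℂ E] [CompleteSpace E]

/-- Representations `p k` of algebras `C k` with states `σ k` on a Hilbert space that are free with
respect to the vector `Ω`: the subspaces `H k` are orthogonal to each other and to `Ω`, and the
centred elements of `C k` map `Ω` and every `H l`, `l ≠ k`, into `H k`. -/
structure IsFreeRealization (p : ∀ k, C k →⋆ₐ[ℂ] (E →L[ℂ] E)) (Ω : E)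
    (H : K → Submodule ℂ E) : Prop where
  inner_self : ⟪Ω, Ω⟫_ℂ = 1
  inner_eq_zero : ∀ k, ∀ x ∈ H k, ⟪Ω, x⟫_ℂ = 0
  orthogonal : ∀ k l, k ≠ l → ∀ x ∈ H k, ∀ y ∈ H l, ⟪x, y⟫_ℂ = 0
  map_vector : ∀ k c, σ k c = 0 → p k c Ω ∈ H k
  map_subspace : ∀ k l c, σ k c = 0 → l ≠ k → ∀ x ∈ H l, p k c x ∈ H k

/-- The product of the centred letters of a word, applied to the vector `Ω`. -/
noncomputable def wordProd (p : ∀ k, C k →⋆ₐ[ℂ] (E →L[ℂ] E)) (Ω : E) : List (Letter C) → E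
  | [] => Ω
  | x :: l => p x.1 ((σ x.1).center x.2) (wordProd p Ω l)

/-- The linear map on the span of the words that is `wordProd` on the words. -/
noncomputable def realize (p : ∀ k, C k →⋆ₐ[ℂ] (E →L[ℂ] E)) (Ω : E) : PreFock σ →ₗ[ℂ] E :=
  liftWord σ fun w => wordProd σ p Ω w.1

theorem realize_wordVec (p : ∀ k, C k →⋆ₐ[ℂ] (E →L[ℂ] E)) (Ω : E) (w : Word C) :
    realize σ p Ω (wordVec σ w) = wordProd σ p Ω w.1 := liftWord_wordVec _ _ _

theorem map_eq_smul_add_center (p : ∀ k, C k →⋆ₐ[ℂ] (E →L[ℂ] E)) (k : K) (c : C k) (x : E) :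
    p k c x = σ k c • x + p k ((σ k).center c) x := by
  rw [CStarState.center_apply, map_sub, map_smul, map_one]
  simp

/-- No freeness is needed: `leftMul` was defined by splitting `c` times the leading letter into its
scalar and its centred part, and this splitting is valid in every unital representation. -/
theorem realize_leftMul (p : ∀ k, C k →⋆ₐ[ℂ] (E →L[ℂ] E)) (Ω : E) (k : K) (c : C k)
    (x : PreFock σ) : realize σ p Ω (leftMul σ k c x) = p k c (realize σ p Ω x) := by
  induction x using preFock_induction with
  | h0 => simp
  | hadd x y hx hy => simp only [map_add, hx, hy]
  | hw d w =>
    simp only [map_smul]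
    congr 1
    -- The two summands of `leftMul_wordVec` are the scalar and the centred part of `c * lead σ k
    -- w`; they recombine after `realize`.
    have key : realize σ p Ω (leftMul σ k c (wordVec σ w)) =
        p k (c * lead σ k w) (wordProd σ p Ω (rest k w).1) := by
      rw [leftMul_wordVec, map_add, map_smul, realize_wordVec, realize_wordVec,
        map_eq_smul_add_center σ p k (c * lead σ k w)]
      rfl
    rw [key, map_mul, realize_wordVec, mul_apply_eq_comp]
    congr 1
    by_cases hw : ∀ x ∈ w.1.head?, x.1 ≠ k
    · rw [lead_of_ne σ hw, rest_of_ne hw, map_one]; rfl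
    · obtain ⟨b, w, h', rfl⟩ := eq_consWord hw
      rw [lead_consWord, rest_consWord]; rfl

namespace IsFreeRealization

variable {σ} {p : ∀ k, C k →⋆ₐ[ℂ] (E →L[ℂ] E)} {Ω : E} {H : K → Submodule ℂ E}

/-- The innermost letter moves `Ω` into its own subspace, and each further letter, having a
different index from the one before, moves the vector on into the subspace of its index. -/
theorem wordProd_mem (h : IsFreeRealization σ p Ω H) (x : Letter C) (l : List (Letter C))
    (hl : (x :: l).IsChain (fun x y => x.1 ≠ y.1)) : wordProd σ p Ω (x :: l) ∈ H x.1 := by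
  induction l generalizing x with
  | nil => exact h.map_vector _ _ (CStarState.map_center _ _)
  | cons y l ih =>
    exact h.map_subspace _ y.1 _ (CStarState.map_center _ _)
      (List.isChain_cons_cons.1 hl).1.symm _ (ih y hl.tail)

theorem inner_wordProd_cons (h : IsFreeRealization σ p Ω H) {k : K} {x : E} (hx : x ∈ H k)
    {l : List (Letter C)} (hl : l.IsChain (fun x y => x.1 ≠ y.1)) (hk : ∀ y ∈ l.head?, y.1 ≠ k) :
    ⟪wordProd σ p Ω l, x⟫_ℂ = 0 := by
  cases l with
  | nil => exact h.inner_eq_zero k x hx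
  | cons y l => exact h.orthogonal _ _ (by simpa using hk) _ (h.wordProd_mem y l hl) _ hx

/-- Words with different leading indices lie in orthogonal subspaces. If both leading letters have
index `i`, move the left one across as an adjoint. The product `s` splits into its expectation,
which gives the factor `letterInner`, and its centred part, which sends the remaining word `v` into
`H i`. That contribution is orthogonal to the word `u`, which does not begin with `i`. -/
theorem inner_wordProd (h : IsFreeRealization σ p Ω H) :
    ∀ u v : List (Letter C), u.IsChain (fun x y => x.1 ≠ y.1) → v.IsChain (fun x y => x.1 ≠ y.1) →
      ⟪wordProd σ p Ω u, wordProd σ p Ω v⟫_ℂ = wordInner σ u v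
  | [], [], _, _ => h.inner_self
  | [], y :: v, _, hv => h.inner_wordProd_cons (h.wordProd_mem y v hv) List.isChain_nil (by simp)
  | x :: u, [], hu, _ => by
    rw [← inner_conj_symm, ← conj_wordInner]
    congr 1
    exact h.inner_wordProd_cons (h.wordProd_mem x u hu) List.isChain_nil (by simp)
  | ⟨i, a⟩ :: u, ⟨j, b⟩ :: v, hu, hv => by
    by_cases hij : i = j
    · subst hij
      have hut : u.IsChain (fun x y => x.1 ≠ y.1) := hu.tail
      set s := star ((σ i).center a) * (σ i).center b with hs
      -- The letter `s` has the same index as the letter `b` that it replaces, so the word stays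
      -- alternating.
      have hmem : p i ((σ i).center s) (wordProd σ p Ω v) ∈ H i :=
        h.wordProd_mem ⟨i, s⟩ v (by
          cases v with
          | nil => simp
          | cons z v =>
            exact List.IsChain.cons_cons (List.isChain_cons_cons.1 hv).1 hv.tail)
      have hstep : ⟪wordProd σ p Ω (⟨i, a⟩ :: u), wordProd σ p Ω (⟨i, b⟩ :: v)⟫_ℂ =
          ⟪wordProd σ p Ω u, p i s (wordProd σ p Ω v)⟫_ℂ := by
        rw [hs, map_mul, map_star, mul_apply_eq_comp,
          ContinuousLinearMap.star_eq_adjoint, ContinuousLinearMap.adjoint_inner_right]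
        rfl
      rw [hstep, map_eq_smul_add_center σ p i s, inner_add_right, inner_smul_right,
        h.inner_wordProd_cons hmem hut (head_ne_of_isChain_cons hu), h.inner_wordProd u v hut hv.tail,
        wordInner, letterInner_same, add_zero]
    · rw [h.inner_wordProd_cons (h.wordProd_mem _ v hv) hu (by simpa using hij), wordInner,
        letterInner_ne σ hij, zero_mul]

theorem norm_realize (h : IsFreeRealization σ p Ω H) (x : PreFock σ) :
    ‖realize σ p Ω x‖ = ‖x‖ := by
  have key : ∀ x y : PreFock σ, ⟪realize σ p Ω x, realize σ p Ω y⟫_ℂ = ⟪x, y⟫_ℂ := by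
    intro x y
    induction x using preFock_induction with
    | h0 => simp
    | hadd x x' hx hx' => simp [inner_add_left, hx, hx']
    | hw c u =>
      induction y using preFock_induction with
      | h0 => simp
      | hadd y y' hy hy' => simp only [map_add, inner_add_right, hy, hy']
      | hw d v =>
        simp only [map_smul, inner_smul_left, inner_smul_right, realize_wordVec, inner_wordVec]
        rw [h.inner_wordProd _ _ u.2 v.2]
  rw [@norm_eq_sqrt_re_inner ℂ, @norm_eq_sqrt_re_inner ℂ, key]

/-- Both maps `realize` preserve the same seminorm on the span of the words, so the identity of that
span induces an isometry between their dense ranges. It extends to a unitary, and the intertwining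
relation passes from the dense range to all vectors. -/
theorem exists_intertwiner (h : IsFreeRealization σ p Ω H) (hp : DenseRange (realize σ p Ω))
    {E' : Type*} [NormedAddCommGroup E'] [InnerProductSpace ℂ E'] [CompleteSpace E']
    {p' : ∀ k, C k →⋆ₐ[ℂ] (E' →L[ℂ] E')} {Ω' : E'} {H' : K → Submodule ℂ E'}
    (h' : IsFreeRealization σ p' Ω' H') (hp' : DenseRange (realize σ p' Ω')) :
    ∃ U : E ≃ₗᵢ[ℂ] E', U Ω = Ω' ∧ ∀ k c x, U (p k c x) = p' k c (U x) := by
  have hn : ∀ x, ‖realize σ p' Ω' (LinearEquiv.refl ℂ (PreFock σ) x)‖ = ‖realize σ p Ω x‖ :=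
    fun x => by rw [h.norm_realize, h'.norm_realize]; rfl
  let U := (LinearEquiv.refl ℂ (PreFock σ)).extendOfIsometry (realize σ p Ω) (realize σ p' Ω')
    hp hp' hn
  have hU : ∀ x, U (realize σ p Ω x) = realize σ p' Ω' x :=
    LinearEquiv.extendOfIsometry_eq _ _ _ hp hp' hn
  refine ⟨U, ?_, fun k c x => ?_⟩
  · have := hU (wordVec σ ⟨[], List.isChain_nil⟩)
    rwa [realize_wordVec, realize_wordVec] at this
  · refine hp.induction_on (p := fun x => U (p k c x) = p' k c (U x)) x ?_ fun y => ?_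
    · exact isClosed_eq (U.continuous.comp (p k c).continuous) ((p' k c).continuous.comp U.continuous)
    · rw [← realize_leftMul, hU, hU, realize_leftMul]

end IsFreeRealization
end

/-! ### Subspaces of the Fock space determined by the leading letter -/

section
variable {I : Type*} {A : I → Type*} [∀ i, CStarAlgebra (A i)] (τ : ∀ i, CStarState (A i))

theorem rep_wordVec (i : I) (a : A i) (w : Word A) (hw : ∀ x ∈ w.1.head?, x.1 ≠ i) :
    rep τ i a (wordVec τ w : Fock τ) =
      τ i a • (wordVec τ w : Fock τ) + (wordVec τ (consWord i a w hw) : Fock τ) := by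
  rw [rep_coe, leftMul_wordVec, UniformSpace.Completion.coe_add, UniformSpace.Completion.coe_smul]
  simp only [lead_of_ne τ hw, rest_of_ne hw, mul_one]

/-- The vacuum is cyclic: words are built up letter by letter, and their span is dense. -/
theorem eq_top_of_forall_rep_mem {M : Submodule ℂ (Fock τ)} (hM : IsClosed (M : Set (Fock τ)))
    (h0 : vacuum τ ∈ M) (h : ∀ i a, ∀ x ∈ M, rep τ i a x ∈ M) : M = ⊤ := by
  have hw : ∀ (l : List (Letter A)) (hl : l.IsChain (fun x y => x.1 ≠ y.1)),
      (wordVec τ ⟨l, hl⟩ : Fock τ) ∈ M := by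
    intro l
    induction l with
    | nil => exact fun _ => h0
    | cons x l ih =>
      intro hl
      have h1 := h x.1 x.2 _ (ih hl.tail)
      rw [rep_wordVec τ x.1 x.2 ⟨l, hl.tail⟩ (head_ne_of_isChain_cons hl)] at h1
      -- Applying the letter to the shorter word gives the longer word plus a multiple of the
      -- shorter one, and the latter is already in `M`.
      exact (Submodule.add_mem_iff_right M (M.smul_mem _ (ih hl.tail))).1 h1
  refine (Submodule.eq_top_iff'.2 fun x => ?_)
  induction x using UniformSpace.Completion.induction_on with
  | hp => exact hM
  | ih x =>
    induction x using preFock_induction with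
    | h0 => rw [UniformSpace.Completion.coe_zero]; exact M.zero_mem
    | hadd x y hx hy => rw [UniformSpace.Completion.coe_add]; exact M.add_mem hx hy
    | hw c w => rw [UniformSpace.Completion.coe_smul]; exact M.smul_mem _ (hw _ _)

/-- The closed span of the words whose leading letter has its index in `S`. -/
noncomputable def headSpan (S : Set I) : Submodule ℂ (Fock τ) :=
  (Submodule.span ℂ {x | ∃ w : Word A, (∃ y ∈ w.1.head?, y.1 ∈ S) ∧
    (wordVec τ w : Fock τ) = x}).topologicalClosure

theorem wordVec_mem_headSpan {S : Set I} {w : Word A} (hw : ∃ y ∈ w.1.head?, y.1 ∈ S) :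
    (wordVec τ w : Fock τ) ∈ headSpan τ S :=
  Submodule.le_topologicalClosure _ (Submodule.subset_span ⟨w, hw, rfl⟩)

theorem isClosed_headSpan (S : Set I) : IsClosed (headSpan τ S : Set (Fock τ)) :=
  Submodule.isClosed_topologicalClosure _

theorem headSpan_le {S : Set I} {M : Submodule ℂ (Fock τ)} (hM : IsClosed (M : Set (Fock τ)))
    (h : ∀ w : Word A, (∃ y ∈ w.1.head?, y.1 ∈ S) → (wordVec τ w : Fock τ) ∈ M) :
    headSpan τ S ≤ M := by
  refine Submodule.topologicalClosure_minimal _ (Submodule.span_le.2 ?_) hM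
  rintro _ ⟨w, hw, rfl⟩
  exact h w hw

theorem inner_headSpan_eq_zero {S : Set I} {x : Fock τ}
    (h : ∀ w : Word A, (∃ y ∈ w.1.head?, y.1 ∈ S) → ⟪x, (wordVec τ w : Fock τ)⟫_ℂ = 0)
    {y : Fock τ} (hy : y ∈ headSpan τ S) : ⟪x, y⟫_ℂ = 0 :=
  headSpan_le τ (M := (innerSL ℂ x).ker) (innerSL ℂ x).isClosed_ker h hy

theorem inner_vacuum_headSpan {S : Set I} {x : Fock τ} (hx : x ∈ headSpan τ S) :
    ⟪vacuum τ, x⟫_ℂ = 0 := by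
  refine inner_headSpan_eq_zero τ (fun w hw => ?_) hx
  rw [vacuum, UniformSpace.Completion.inner_coe, inner_wordVec]
  obtain ⟨_ | ⟨x, l⟩, hl⟩ := w
  · simp at hw
  · rfl

theorem inner_headSpan_headSpan {S T : Set I} (hST : Disjoint S T) {x y : Fock τ}
    (hx : x ∈ headSpan τ S) (hy : y ∈ headSpan τ T) : ⟪x, y⟫_ℂ = 0 := by
  refine inner_headSpan_eq_zero τ (fun w hw => ?_) hy
  rw [← inner_conj_symm, inner_headSpan_eq_zero τ (fun v hv => ?_) hx, map_zero]
  rw [UniformSpace.Completion.inner_coe, inner_wordVec]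
  obtain ⟨_ | ⟨a, l⟩, hl⟩ := w
  · simp at hw
  obtain ⟨_ | ⟨b, m⟩, hm⟩ := v
  · simp at hv
  have ha : a.1 ∈ T := by simpa using hw
  have hb : b.1 ∈ S := by simpa using hv
  rw [wordInner, letterInner_ne τ fun hab => Set.disjoint_left.1 hST hb (hab ▸ ha), zero_mul]

/-- The empty word is the vacuum itself, and every nonempty word is orthogonal to it; linearity and
closedness do the rest. -/
theorem sub_inner_vacuum_mem_headSpan (x : Fock τ) :
    x - ⟪vacuum τ, x⟫_ℂ • vacuum τ ∈ headSpan τ Set.univ := by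
  induction x using UniformSpace.Completion.induction_on with
  | hp => exact (isClosed_headSpan τ _).preimage (by fun_prop)
  | ih x =>
    induction x using preFock_induction with
    | h0 =>
      rw [UniformSpace.Completion.coe_zero, inner_zero_right, zero_smul, sub_zero]
      exact zero_mem _
    | hadd x y hx hy =>
      rw [UniformSpace.Completion.coe_add, inner_add_right, add_smul, add_sub_add_comm]
      exact add_mem hx hy
    | hw c w =>
      rw [UniformSpace.Completion.coe_smul, inner_smul_right, mul_smul, ← smul_sub]
      refine Submodule.smul_mem _ _ ?_
      rw [vacuum, UniformSpace.Completion.inner_coe, inner_wordVec]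
      obtain ⟨_ | ⟨a, l⟩, hl⟩ := w
      · simp [wordInner]
      · rw [show wordInner τ [] (a :: l) = 0 from rfl, zero_smul, sub_zero]
        exact wordVec_mem_headSpan τ ⟨a, by simp⟩

theorem rep_mem_headSpan {i : I} {a : A i} (ha : τ i a = 0) {w : Word A}
    (hw : ∀ x ∈ w.1.head?, x.1 ≠ i) : rep τ i a (wordVec τ w : Fock τ) ∈ headSpan τ {i} := by
  rw [rep_wordVec τ i a w hw, ha, zero_smul, zero_add]
  exact wordVec_mem_headSpan τ ⟨⟨i, a⟩, by simp [consWord]⟩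

/-- A word whose leading index is in `S` does not begin with `i`, so a centred element of `A i`
merely adds a letter in front. The preimage of a closed subspace is closed, which reduces the claim
to words. -/
theorem rep_mem_headSpan_of_mem {i : I} {a : A i} (ha : τ i a = 0) {S : Set I} (hS : i ∉ S)
    {x : Fock τ} (hx : x ∈ headSpan τ S) : rep τ i a x ∈ headSpan τ {i} := by
  refine headSpan_le τ (M := (headSpan τ {i}).comap (rep τ i a).toLinearMap)
    ((isClosed_headSpan τ _).preimage (rep τ i a).continuous) (fun w hw => ?_) hx
  refine rep_mem_headSpan τ ha fun y hy h => hS ?_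
  obtain ⟨z, hz, hzS⟩ := hw
  rw [← h, Option.mem_unique hy hz]
  exact hzS

end

/-! ### The reduced free product of a subfamily acting as `b ⊗ 1` -/

section
variable {I J : Type*} {A : I → Type*} [∀ i, CStarAlgebra (A i)] (τ : ∀ i, CStarState (A i))
  (f : J ↪ I)

/-- By construction `incl` inverts the compression on operators satisfying `IsAmpl`, and `IsAmpl` is
this commutation relation with the compression in place of `b`. -/
theorem coe_incl_comp_concatL (b : ReducedFreeProduct fun j => τ (f j)) (w : Tail (A := A) f) :
    (incl τ f b : Fock τ →L[ℂ] Fock τ) ∘L concatL τ w =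
      concatL τ w ∘L (b : Fock (fun j => τ (f j)) →L[ℂ] Fock (fun j => τ (f j))) := by
  let e := StarAlgEquiv.ofInjective (compressHom τ f) (compressHom_injective τ f)
  let T : ampl τ f := e.symm (StarSubalgebra.inclusion (operatorAlgebra_le_range τ f) b)
  have hT : compress τ f T.1 = b :=
    congrArg Subtype.val (e.apply_symm_apply
      (StarSubalgebra.inclusion (operatorAlgebra_le_range τ f) b))
  rw [← hT]
  exact T.2.2 w

theorem concatL_vacuum (w : Tail (A := A) f) :
    concatL τ w (vacuum fun j => τ (f j)) = (wordVec τ w.word : Fock τ) := by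
  rw [vacuum, concatL_coe, rightConcat_wordVec]
  rfl

theorem concatL_mem_headSpan (w : Tail (A := A) f) {x : Fock fun j => τ (f j)}
    (hx : x ∈ headSpan (fun j => τ (f j)) Set.univ) :
    concatL τ w x ∈ headSpan τ (Set.range f) := by
  refine headSpan_le _ (M := (headSpan τ (Set.range f)).comap (concatL τ w).toLinearMap)
    ((isClosed_headSpan τ _).preimage (concatL τ w).continuous) (fun u hu => ?_) hx
  change concatL τ w (wordVec (fun j => τ (f j)) u : Fock fun j => τ (f j)) ∈
    headSpan τ (Set.range f)
  rw [concatL_coe, rightConcat_wordVec]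
  obtain ⟨_ | ⟨y, l⟩, hl⟩ := u
  · simp at hu
  · exact wordVec_mem_headSpan τ ⟨mapLetter f y, by simp [concat], y.1, rfl⟩

/-- The word `w` is the vacuum of the subfamily followed by the tail `w`, so `b` acts on that vacuum
and leaves the tail alone. As `b` is centred, its value at the vacuum is orthogonal to the vacuum,
hence a limit of combinations of nonempty words in the subfamily. -/
theorem incl_mem_headSpan {b : ReducedFreeProduct fun j => τ (f j)}
    (hb : freeState (fun j => τ (f j)) b = 0) {w : Word A}
    (hw : ∀ j, ∀ x ∈ w.1.head?, x.1 ≠ f j) :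
    (incl τ f b : Fock τ →L[ℂ] Fock τ) (wordVec τ w : Fock τ) ∈ headSpan τ (Set.range f) := by
  have h1 := DFunLike.congr_fun (coe_incl_comp_concatL τ f b ⟨w, hw⟩) (vacuum fun j => τ (f j))
  simp only [ContinuousLinearMap.comp_apply, concatL_vacuum] at h1
  rw [h1]
  refine concatL_mem_headSpan τ f _ ?_
  have h2 := sub_inner_vacuum_mem_headSpan (fun j => τ (f j))
    ((b : Fock (fun j => τ (f j)) →L[ℂ] Fock (fun j => τ (f j))) (vacuum fun j => τ (f j)))
  have h3 : ⟪vacuum (fun j => τ (f j)), (b : Fock (fun j => τ (f j)) →L[ℂ]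
    Fock (fun j => τ (f j))) (vacuum fun j => τ (f j))⟫_ℂ = 0 := hb
  rwa [h3, zero_smul, sub_zero] at h2

theorem incl_mem_headSpan_of_mem {b : ReducedFreeProduct fun j => τ (f j)}
    (hb : freeState (fun j => τ (f j)) b = 0) {S : Set I} (hS : Disjoint (Set.range f) S)
    {x : Fock τ} (hx : x ∈ headSpan τ S) :
    (incl τ f b : Fock τ →L[ℂ] Fock τ) x ∈ headSpan τ (Set.range f) := by
  refine headSpan_le τ (M := (headSpan τ (Set.range f)).comap
      (incl τ f b : Fock τ →L[ℂ] Fock τ).toLinearMap)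
    ((isClosed_headSpan τ _).preimage (incl τ f b : Fock τ →L[ℂ] Fock τ).continuous)
    (fun w hw => ?_) hx
  refine incl_mem_headSpan τ f hb fun j y hy h => ?_
  obtain ⟨z, hz, hzS⟩ := hw
  obtain rfl := Option.mem_unique hy hz
  exact Set.disjoint_left.1 hS ⟨j, h.symm⟩ hzS

end
end ReducedFreeProduct

/-! ### Functoriality of the direct limit and removal of the twist -/

namespace CStarDirectLimit
open UniformSpace
section
variable {A A' : ℕ → Type*} [∀ n, CStarAlgebra (A n)] [∀ n, CStarAlgebra (A' n)]
  {α : ∀ n, A n →⋆ₐ[ℂ] A (n + 1)} {α' : ∀ n, A' n →⋆ₐ[ℂ] A' (n + 1)}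

/-- The map of threads induced by a morphism of direct systems. -/
noncomputable def Thread.map (φ : ∀ n, A n →⋆ₐ[ℂ] A' n)
    (h : ∀ n x, φ (n + 1) (α n x) = α' n (φ n x)) : Thread α →⋆ₐ[ℂ] Thread α' where
  toFun x := ⟨fun n => φ n (x.eval n), by
    filter_upwards [x.eventually] with n hn
    rw [hn, h]⟩
  map_one' := Subtype.ext (funext fun n => map_one (φ n))
  map_mul' x y := Subtype.ext (funext fun n => map_mul (φ n) (x.eval n) (y.eval n))
  map_zero' := Subtype.ext (funext fun n => map_zero (φ n))
  map_add' x y := Subtype.ext (funext fun n => map_add (φ n) (x.eval n) (y.eval n))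
  commutes' c := Subtype.ext (funext fun n => AlgHomClass.commutes (φ n) c)
  map_star' x := Subtype.ext (funext fun n => map_star (φ n) (x.eval n))

/-- Each ⋆-homomorphism `φ n` is contractive, and the seminorm of a thread is the limit of the norms
of its members. -/
theorem Thread.norm_map_le (φ : ∀ n, A n →⋆ₐ[ℂ] A' n)
    (h : ∀ n x, φ (n + 1) (α n x) = α' n (φ n x)) (x : Thread α) :
    ‖Thread.map φ h x‖ ≤ ‖x‖ :=
  le_of_tendsto_of_tendsto' (Thread.map φ h x).tendsto_norm x.tendsto_norm
    fun n => NonUnitalStarAlgHom.norm_apply_le (φ n) (x.eval n)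

theorem Thread.continuous_map (φ : ∀ n, A n →⋆ₐ[ℂ] A' n)
    (h : ∀ n x, φ (n + 1) (α n x) = α' n (φ n x)) : Continuous (Thread.map φ h) :=
  AddMonoidHomClass.continuous_of_bound (Thread.map φ h) 1 fun x => by
    simpa using Thread.norm_map_le φ h x

/-- The homomorphism of direct limits induced by a morphism of direct systems. -/
noncomputable def map (φ : ∀ n, A n →⋆ₐ[ℂ] A' n)
    (h : ∀ n x, φ (n + 1) (α n x) = α' n (φ n x)) :
    CStarDirectLimit α →⋆ₐ[ℂ] CStarDirectLimit α' where
  __ := Completion.mapRingHom (Thread.map φ h : Thread α →+* Thread α') (Thread.continuous_map φ h)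
  commutes' c := by
    refine (Completion.mapRingHom_coe (f := (Thread.map φ h : Thread α →+* Thread α'))
      (Thread.continuous_map φ h) (algebraMap ℂ (Thread α) c)).trans ?_
    exact congrArg ((↑) : Thread α' → Completion (Thread α'))
      (AlgHomClass.commutes (Thread.map φ h) c)
  map_star' x := by
    refine Completion.induction_on
      (p := fun x : CStarDirectLimit α =>
        Completion.map (Thread.map φ h) (star x : CStarDirectLimit α) =
          (star (show CStarDirectLimit α' from Completion.map (Thread.map φ h) x) :
            CStarDirectLimit α')) x ?_ ?_
    · exact isClosed_eq (Completion.continuous_map.comp (continuous_star_aux α))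
        ((continuous_star_aux α').comp Completion.continuous_map)
    · intro a
      have hu := uniformContinuous_addMonoidHom_of_continuous (Thread.continuous_map φ h)
      rw [← coe_star, Completion.map_coe hu, Completion.map_coe hu, map_star]
      exact coe_star α' _

theorem map_comp_map (φ : ∀ n, A n →⋆ₐ[ℂ] A' n)
    (h : ∀ n x, φ (n + 1) (α n x) = α' n (φ n x)) (ψ : ∀ n, A' n →⋆ₐ[ℂ] A n)
    (h' : ∀ n x, ψ (n + 1) (α' n x) = α n (ψ n x)) (hψφ : ∀ n x, ψ n (φ n x) = x) :
    (map ψ h').comp (map φ h) = StarAlgHom.id ℂ (CStarDirectLimit α) := by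
  ext x
  refine Completion.induction_on
    (p := fun x : CStarDirectLimit α =>
      Completion.map (Thread.map ψ h') (Completion.map (Thread.map φ h) x) = x) x ?_ fun a => ?_
  · exact isClosed_eq (Completion.continuous_map.comp Completion.continuous_map) continuous_id
  · have hu := uniformContinuous_addMonoidHom_of_continuous (Thread.continuous_map φ h)
    have hu' := uniformContinuous_addMonoidHom_of_continuous (Thread.continuous_map ψ h')
    rw [Completion.map_coe hu, Completion.map_coe hu']
    exact congrArg ((↑) : Thread α → Completion (Thread α))
      (Subtype.ext (funext fun n => hψφ n (a.eval n)))

/-- Isomorphic direct systems have isomorphic direct limits. -/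
noncomputable def congr (φ : ∀ n, A n ≃⋆ₐ[ℂ] A' n)
    (h : ∀ n x, φ (n + 1) (α n x) = α' n (φ n x)) :
    CStarDirectLimit α ≃⋆ₐ[ℂ] CStarDirectLimit α' :=
  have h' : ∀ n x, (φ (n + 1)).symm (α' n x) = α n ((φ n).symm x) := fun n x => by
    rw [StarAlgEquiv.symm_apply_eq, h, StarAlgEquiv.apply_symm_apply]
  StarAlgEquiv.ofStarAlgHom (map (fun n => (φ n : A n →⋆ₐ[ℂ] A' n)) h)
    (map (fun n => ((φ n).symm : A' n →⋆ₐ[ℂ] A n)) h')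
    (map_comp_map _ h _ h' fun n x => (φ n).symm_apply_apply x)
    (map_comp_map _ h' _ h fun n x => (φ n).apply_symm_apply x)

/-- If the automorphisms of the members of a direct system that preserve given functions extend to
the next member, then twisting the connecting maps by such automorphisms does not change the direct
limit. -/
theorem nonempty_equiv_of_extension (ι : ∀ n, A n →⋆ₐ[ℂ] A (n + 1)) (φ : ∀ n, A n → ℂ)
    (hext : ∀ n (σ : A n ≃⋆ₐ[ℂ] A n), (∀ b, φ n (σ b) = φ n b) →
      ∃ β : A (n + 1) ≃⋆ₐ[ℂ] A (n + 1),
        (∀ b, β (ι n b) = ι n (σ b)) ∧ ∀ b, φ (n + 1) (β b) = φ (n + 1) b)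
    (γ : ∀ n, A n ≃⋆ₐ[ℂ] A n) (hγ : ∀ n b, φ n (γ n b) = φ n b) :
    Nonempty (CStarDirectLimit (fun n => (γ (n + 1) : A (n + 1) →⋆ₐ[ℂ] A (n + 1)).comp (ι n)) ≃⋆ₐ[ℂ]
      CStarDirectLimit ι) := by
  have step : ∀ n (σ : {σ : A n ≃⋆ₐ[ℂ] A n // ∀ b, φ n (σ b) = φ n b}),
      ∃ σ' : {σ : A (n + 1) ≃⋆ₐ[ℂ] A (n + 1) // ∀ b, φ (n + 1) (σ b) = φ (n + 1) b},
        ∀ b, σ'.1 (γ (n + 1) (ι n b)) = ι n (σ.1 b) := by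
    intro n σ
    obtain ⟨β, hβ, hβφ⟩ := hext n σ.1 σ.2
    -- The new automorphism is `β ∘ γ_{n+1}⁻¹`: the inverse cancels the twist in the connecting map,
    -- and `β` then acts on the image of `ι n` as `σ`.
    refine ⟨⟨(γ (n + 1)).symm.trans β, fun b => ?_⟩, fun b => ?_⟩
    · rw [StarAlgEquiv.trans_apply, hβφ, ← hγ, StarAlgEquiv.apply_symm_apply]
    · rw [StarAlgEquiv.trans_apply, StarAlgEquiv.symm_apply_apply, hβ]
  choose next hnext using step
  -- The recursion may start with the identity because `γ 0` does not occur in the twisted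
  -- connecting maps.
  let σ : ∀ n, {σ : A n ≃⋆ₐ[ℂ] A n // ∀ b, φ n (σ b) = φ n b} :=
    fun n => Nat.rec ⟨StarAlgEquiv.refl ℂ _, fun _ => rfl⟩ next n
  exact ⟨congr (fun n => (σ n).1) fun n b => hnext n (σ n) b⟩

end
end CStarDirectLimit

/-! ### Extending an automorphism by the identity of one more free factor -/

namespace ReducedFreeProduct
universe u

/-- The family of two types. -/
def Pair (B C : Type u) : Bool → Type u
  | false => B
  | true => C

noncomputable instance (B C : Type u) [CStarAlgebra B] [CStarAlgebra C] :
    ∀ k, CStarAlgebra (Pair B C k)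
  | false => inferInstanceAs (CStarAlgebra B)
  | true => inferInstanceAs (CStarAlgebra C)

/-- The family of two states. -/
noncomputable def pairState {B C : Type u} [CStarAlgebra B] [CStarAlgebra C] (φ : CStarState B)
    (ψ : CStarState C) : ∀ k, CStarState (Pair B C k)
  | false => φ
  | true => ψ

/-- The family of two homomorphisms to the same algebra. -/
def pairHom {B C : Type u} {D : Type*} [CStarAlgebra B] [CStarAlgebra C] [CStarAlgebra D] (p : B →⋆ₐ[ℂ] D)
    (q : C →⋆ₐ[ℂ] D) : ∀ k, Pair B C k →⋆ₐ[ℂ] D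
  | false => p
  | true => q

section
-- With index types in the lowest universe the reduced free product lies in the universe of the `A
-- i`, as `Pair` requires.
variable {J I : Type} {A : I → Type u} [∀ i, CStarAlgebra (A i)] (τ : ∀ i, CStarState (A i))
  (f : J ↪ I) (k : I)

/-- The representations on the free product Hilbert space of the reduced free product of a
subfamily, twisted by the automorphism `γ`, and of one further algebra. -/
noncomputable def twistedPair
    (γ : ReducedFreeProduct (fun j => τ (f j)) ≃⋆ₐ[ℂ] ReducedFreeProduct (fun j => τ (f j))) :
    ∀ b, Pair (ReducedFreeProduct fun j => τ (f j)) (A k) b →⋆ₐ[ℂ] (Fock τ →L[ℂ] Fock τ) :=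
  pairHom ((operatorAlgebra τ).subtype.comp ((incl τ f).comp
    (γ : ReducedFreeProduct (fun j => τ (f j)) →⋆ₐ[ℂ] ReducedFreeProduct (fun j => τ (f j)))))
    (rep τ k)

variable {f k}
  (γ : ReducedFreeProduct (fun j => τ (f j)) ≃⋆ₐ[ℂ] ReducedFreeProduct (fun j => τ (f j)))

/-- This is where invariance of the state enters: if `c` is centred then so is `γ c`, so the twisted
action moves the subspaces in the same way as the untwisted one. -/
theorem isFreeRealization_twistedPair (hk : k ∉ Set.range f)
    (hγ : ∀ b, freeState (fun j => τ (f j)) (γ b) = freeState (fun j => τ (f j)) b) :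
    IsFreeRealization (pairState (freeState fun j => τ (f j)) (τ k)) (twistedPair τ f k γ)
      (vacuum τ) (fun b => headSpan τ (bif b then {k} else Set.range f)) where
  inner_self := norm_vacuum_sq τ
  inner_eq_zero b x hx := inner_vacuum_headSpan τ hx
  orthogonal b c hbc x hx y hy := by
    refine inner_headSpan_headSpan τ ?_ hx hy
    cases b <;> cases c <;> simp_all
  map_vector
    | false, c, hc => incl_mem_headSpan τ f ((hγ c).trans hc) (by simp)
    | true, c, hc => rep_mem_headSpan τ hc (by simp)
  map_subspace
    | false, false, _, _, h, _, _ => (h rfl).elim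
    | true, true, _, _, h, _, _ => (h rfl).elim
    | false, true, c, hc, _, x, hx =>
      incl_mem_headSpan_of_mem τ f ((hγ c).trans hc) (by simpa using hk) hx
    | true, false, c, hc, _, x, hx => rep_mem_headSpan_of_mem τ hc hk hx

theorem twistedPair_mem : ∀ b c, twistedPair τ f k γ b c ∈ operatorAlgebra τ
  | false, c => (incl τ f (γ c)).2
  | true, c => rep_mem τ k c

/-- Since `γ` is surjective, the twist does not change the image of the subfamily's free product.
Hence every free factor is still in the image of the pair. -/
theorem exists_twistedPair_eq_rep (hk : ∀ i, i = k ∨ i ∈ Set.range f) (i : I) (a : A i) :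
    ∃ b c, twistedPair τ f k γ b c = rep τ i a := by
  rcases hk i with rfl | ⟨j, rfl⟩
  · exact ⟨true, a, rfl⟩
  · refine ⟨false, γ.symm (of (fun j => τ (f j)) j a), ?_⟩
    change ((incl τ f (γ (γ.symm (of (fun j => τ (f j)) j a))) : Fock τ →L[ℂ] Fock τ)) = _
    rw [StarAlgEquiv.apply_symm_apply, incl_of]
    rfl

/-- The closure of the range contains the vacuum, the value at the empty word, and is invariant
under the pair by `realize_leftMul`. It is then invariant under all free factors, so
`eq_top_of_forall_rep_mem` applies. -/
theorem denseRange_realize_twistedPair (hk : ∀ i, i = k ∨ i ∈ Set.range f) :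
    DenseRange (realize (pairState (freeState fun j => τ (f j)) (τ k)) (twistedPair τ f k γ)
      (vacuum τ)) := by
  set R := realize (pairState (freeState fun j => τ (f j)) (τ k)) (twistedPair τ f k γ) (vacuum τ)
    with hR
  have hinv : ∀ b c, ∀ x ∈ R.range.topologicalClosure,
      twistedPair τ f k γ b c x ∈ R.range.topologicalClosure := by
    intro b c x hx
    refine Submodule.topologicalClosure_minimal (t := R.range.topologicalClosure.comap
      (twistedPair τ f k γ b c).toLinearMap) _ ?_ ?_ hx
    · rintro _ ⟨y, rfl⟩
      refine Submodule.le_topologicalClosure _ ⟨leftMul _ b c y, ?_⟩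
      rw [hR, realize_leftMul]
      rfl
    · exact (Submodule.isClosed_topologicalClosure _).preimage (twistedPair τ f k γ b c).continuous
  have htop : R.range.topologicalClosure = ⊤ := by
    refine eq_top_of_forall_rep_mem τ (Submodule.isClosed_topologicalClosure _) ?_ ?_
    · exact Submodule.le_topologicalClosure _ ⟨wordVec _ ⟨[], List.isChain_nil⟩,
        realize_wordVec _ _ _ _⟩
    · intro i a x hx
      obtain ⟨b, c, hbc⟩ := exists_twistedPair_eq_rep τ γ hk i a
      rw [← hbc]
      exact hinv b c x hx
  have := Submodule.dense_iff_topologicalClosure_eq_top.2 htop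
  rwa [LinearMap.coe_range] at this

theorem map_mem_operatorAlgebra (Φ : (Fock τ →L[ℂ] Fock τ) →⋆ₐ[ℂ] (Fock τ →L[ℂ] Fock τ))
    (h : ∀ i a, Φ (rep τ i a) ∈ operatorAlgebra τ) {T : Fock τ →L[ℂ] Fock τ}
    (hT : T ∈ operatorAlgebra τ) : Φ T ∈ operatorAlgebra τ := by
  refine StarSubalgebra.topologicalClosure_minimal (t := (operatorAlgebra τ).comap Φ)
    (StarAlgebra.adjoin_le ?_) ?_ hT
  · rintro _ ⟨_, ⟨i, rfl⟩, a, rfl⟩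
    exact h i a
  · exact (isClosed_closure : IsClosed (operatorAlgebra τ : Set (Fock τ →L[ℂ] Fock τ))).preimage
      (map_continuous Φ)

/-- A ⋆-homomorphism of operators that maps the free factors into the reduced free product, as an
endomorphism of the reduced free product. -/
noncomputable def restrictHom (Φ : (Fock τ →L[ℂ] Fock τ) →⋆ₐ[ℂ] (Fock τ →L[ℂ] Fock τ))
    (h : ∀ i a, Φ (rep τ i a) ∈ operatorAlgebra τ) :
    ReducedFreeProduct τ →⋆ₐ[ℂ] ReducedFreeProduct τ :=
  (Φ.comp (operatorAlgebra τ).subtype).codRestrict (operatorAlgebra τ)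
    fun b => map_mem_operatorAlgebra τ Φ h b.2

/-- Both `Φ` and its inverse are continuous and send generators into the operator algebra, so they
preserve it and restrict to mutually inverse homomorphisms. -/
theorem exists_restrict (Φ : (Fock τ →L[ℂ] Fock τ) ≃⋆ₐ[ℂ] (Fock τ →L[ℂ] Fock τ))
    (h : ∀ i a, Φ (rep τ i a) ∈ operatorAlgebra τ)
    (h' : ∀ i a, Φ.symm (rep τ i a) ∈ operatorAlgebra τ) :
    ∃ β : ReducedFreeProduct τ ≃⋆ₐ[ℂ] ReducedFreeProduct τ,
      ∀ b, (β b : Fock τ →L[ℂ] Fock τ) = Φ (b : Fock τ →L[ℂ] Fock τ) :=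
  ⟨StarAlgEquiv.ofStarAlgHom
    (restrictHom τ Φ.toStarAlgHom h)
    (restrictHom τ Φ.symm.toStarAlgHom h')
    (StarAlgHom.ext fun b => Subtype.ext (Φ.symm_apply_apply b.1))
    (StarAlgHom.ext fun b => Subtype.ext (Φ.apply_symm_apply b.1)), fun _ => rfl⟩

/-- A state preserving automorphism of the reduced free product of all members of a family but one
extends to a state preserving automorphism of the reduced free product of the family. -/
theorem exists_extension (hk : Set.range f = {k}ᶜ)
    (hγ : ∀ b, freeState (fun j => τ (f j)) (γ b) = freeState (fun j => τ (f j)) b) :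
    ∃ β : ReducedFreeProduct τ ≃⋆ₐ[ℂ] ReducedFreeProduct τ,
      (∀ b, β (incl τ f b) = incl τ f (γ b)) ∧ ∀ b, freeState τ (β b) = freeState τ b := by
  have hk1 : k ∉ Set.range f := by simp [hk]
  have hk2 : ∀ i, i = k ∨ i ∈ Set.range f := fun i => by
    rw [hk]; exact em _
  -- `U` goes from the untwisted realization, the case of the identity automorphism, to the one
  -- twisted by `γ`.
  obtain ⟨U, hU0, hU⟩ := (isFreeRealization_twistedPair τ (StarAlgEquiv.refl ℂ _) hk1
    fun _ => rfl).exists_intertwiner (denseRange_realize_twistedPair τ _ hk2)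
    (isFreeRealization_twistedPair τ γ hk1 hγ) (denseRange_realize_twistedPair τ γ hk2)
  have hΦ : ∀ b c, U.conjStarAlgEquiv (twistedPair τ f k (StarAlgEquiv.refl ℂ _) b c) =
      twistedPair τ f k γ b c := by
    intro b c
    ext x
    rw [LinearIsometryEquiv.conjStarAlgEquiv_apply_apply, hU,
      LinearIsometryEquiv.apply_symm_apply]
  obtain ⟨β, hβ⟩ := exists_restrict τ U.conjStarAlgEquiv
    (fun i a => by
      obtain ⟨b, c, hbc⟩ := exists_twistedPair_eq_rep τ (StarAlgEquiv.refl ℂ _) hk2 i a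
      rw [← hbc, hΦ]
      exact twistedPair_mem τ γ b c)
    (fun i a => by
      obtain ⟨b, c, hbc⟩ := exists_twistedPair_eq_rep τ γ hk2 i a
      rw [← hbc, ← hΦ, StarAlgEquiv.symm_apply_apply]
      exact twistedPair_mem τ _ b c)
  -- On the first member of the pair, `hΦ` says that conjugation by `U` sends `incl τ f b` to `incl
  -- τ f (γ b)`. The state is preserved because `U` is unitary and fixes the vacuum.
  refine ⟨β, fun b => Subtype.ext ((hβ _).trans (hΦ false b)), fun b => ?_⟩
  change ⟪vacuum τ, (β b : Fock τ →L[ℂ] Fock τ) (vacuum τ)⟫_ℂ =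
    ⟪vacuum τ, (b : Fock τ →L[ℂ] Fock τ) (vacuum τ)⟫_ℂ
  have h0 : U.symm (vacuum τ) = vacuum τ := by rw [LinearIsometryEquiv.symm_apply_eq, hU0]
  rw [hβ, LinearIsometryEquiv.conjStarAlgEquiv_apply_apply, h0]
  rw [← U.inner_map_map (vacuum τ) ((b : Fock τ →L[ℂ] Fock τ) (vacuum τ)), hU0]

end
end ReducedFreeProduct

/-! ### Application to the first members of the sequence -/

namespace FirstFreeProduct
section
universe u
variable {A : ℕ → Type u} [∀ k, CStarAlgebra (A k)] (τ : ∀ k, CStarState (A k))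

theorem range_castSuccEmb (n : ℕ) :
    Set.range (Fin.castSuccEmb : Fin (n + 1) ↪ Fin (n + 1 + 1)) = {Fin.last (n + 1)}ᶜ := by
  ext i
  exact Fin.exists_castSucc_eq (i := i)

/-- `Fin.castSuccEmb` does not change the underlying natural number, so restricting the longer
family along it gives definitionally the shorter family. This lets the general extension result
apply with the last index as the new factor. -/
theorem state_apply (n : ℕ) (b : FirstFreeProduct τ n) :
    state τ n b = ReducedFreeProduct.freeState
      (fun j : Fin (n + 1) => (fun k : Fin (n + 1 + 1) => τ k) (Fin.castSuccEmb j)) b := rfl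

set_option maxHeartbeats 1000000 in
theorem exists_extension {n : ℕ} (γ : FirstFreeProduct τ n ≃⋆ₐ[ℂ] FirstFreeProduct τ n)
    (hγ : ∀ b, state τ n (γ b) = state τ n b) :
    ∃ β : FirstFreeProduct τ (n + 1) ≃⋆ₐ[ℂ] FirstFreeProduct τ (n + 1),
      (∀ b, β (incl τ n b) = incl τ n (γ b)) ∧ ∀ b, state τ (n + 1) (β b) = state τ (n + 1) b := by
  have h := ReducedFreeProduct.exists_extension (I := Fin (n + 1 + 1)) (A := fun k => A k)
    (fun k => τ k) γ (range_castSuccEmb n)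
  exact h fun b => (state_apply τ n _).symm.trans ((hγ b).trans (state_apply τ n b))

end
end FirstFreeProduct

theorem mainTheorem12 {A : ℕ → Type*} [∀ k, CStarAlgebra (A k)] (τ : ∀ k, CStarState (A k))
    (γ : ∀ n, FirstFreeProduct τ n ≃⋆ₐ[ℂ] FirstFreeProduct τ n)
    (hγ : ∀ n b, FirstFreeProduct.state τ n (γ n b) = FirstFreeProduct.state τ n b) :
    Nonempty
      (CStarDirectLimit (fun n =>
          (γ (n + 1) : FirstFreeProduct τ (n + 1) →⋆ₐ[ℂ] FirstFreeProduct τ (n + 1)).comp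
            (FirstFreeProduct.incl τ n)) ≃⋆ₐ[ℂ]
        CStarDirectLimit (fun n => FirstFreeProduct.incl τ n)) :=
  CStarDirectLimit.nonempty_equiv_of_extension (A := FirstFreeProduct τ) (FirstFreeProduct.incl τ)
    (fun n b => FirstFreeProduct.state τ n b) (fun _ => FirstFreeProduct.exists_extension τ) γ hγ
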